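/- Let $K$ be an algebraic function field of one variable over a finite field $F$, i.e. a finite extension of a rational function field $F(x)$. For a place $Q$ of $K$ let $v_Q$ be the normalized discrete valuation at $Q$, and for a divisor $G=\sum_Q n_Q Q$ let $L(G)=\{f\in K\setminus\{0\} : v_Q(f)+n_Q\ge 0 \text{ for all places } Q\}\cup\{0\}$ and $\ell(G)=\dim_F L(G)$. Let $Q_1\neq Q_2$ be rational places of $K$ (places of degree one), and let $R(Q_1,Q_2)$ be the ring of all $f\in K$ that have no poles outside $\{Q_1,Q_2\}$. Put $$H(Q_1,Q_2)=\{(n_1,n_2)\in\mathbb Z^2 : \exists f\in R(Q_1,Q_2)\setminus\{0\},\ v_{Q_1}(f)=-n_1,\ v_{Q_2}(f)=-n_2\},\qquad \tau_{Q_1,Q_2}(i)=\min\{j\in\mathbb Z : (i,j)\in H(Q_1,Q_2)\}\quad(i\in\mathbb Z).$$ Then the minimum defining $\tau_{Q_1,Q_2}(i)$ exists for every $i\in\mathbb Z$. For all integers $a_1,a_2\ge 0$, the set $\{i\in\mathbb Z : i\le a_1,\ \tau_{Q_1,Q_2}(i)\le a_2\}$ is finite and $$\ell(a_1Q_1+a_2Q_2)=\bigl|\{i\in\mathbb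 Z : i\le a_1,\ \tau_{Q_1,Q_2}(i)\le a_2\}\bigr|.$$ Moreover, if for each $i\in\mathbb Z$ a function $f^{(i)}_{Q_1,Q_2}\in R(Q_1,Q_2)\setminus\{0\}$ with $v_{Q_1}(f^{(i)}_{Q_1,Q_2})=-i$ and $v_{Q_2}(f^{(i)}_{Q_1,Q_2})=-\tau_{Q_1,Q_2}(i)$ is chosen, then the functions $f^{(i)}_{Q_1,Q_2}$ with $i\le a_1$ and $\tau_{Q_1,Q_2}(i)\le a_2$ form an $F$-basis of $L(a_1Q_1+a_2Q_2)$. -/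

import Mathlib

/-- A place of the function field `K` over the constant field `F`, given by its ring of regular
functions: a discrete valuation ring containing (the image of) `F` whose field of fractions
is `K`. -/
@[ext]
structure Place (F K : Type*) [Field F] [Field K] [Algebra F K] where
  /-- The ring of functions that are regular at the place. -/
  regularRing : ValuationSubring K
  algebraMap_mem : ∀ c : F, algebraMap F K c ∈ regularRing
  isDVR : IsDiscreteValuationRing regularRing

namespace Place

attribute [instance] Place.isDVR

variable {F K : Type*} [Field F] [Field K] [Algebra F K]

noncomputable instance instAlgebraRing (Q : Place F K) : Algebra F Q.regularRing :=
  ((algebraMap F K).codRestrict Q.regularRing Q.algebraMap_mem).toAlgebra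

/-- The degree of a place: the degree of its residue field over `F`. -/
noncomputable def degree (Q : Place F K) : ℕ :=
  Module.finrank F (IsLocalRing.ResidueField Q.regularRing)

/-- A rational place is a place of degree one. -/
def IsRational (Q : Place F K) : Prop := Q.degree = 1

/-- The order of vanishing `v_Q(f)` of `f` at the place `Q`. It is only meaningful for `f ≠ 0`
(the value at `0` is `0`). The `maximalIdeal`-adic valuation of Mathlib is multiplicative and
sends a uniformizer to `exp (-1)`, hence the sign. -/
noncomputable def ord (Q : Place F K) (f : K) : ℤ :=
  -WithZero.log ((IsDiscreteValuationRing.maximalIdeal Q.regularRing).valuation K f)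

theorem ord_mul (Q : Place F K) {f g : K} (hf : f ≠ 0) (hg : g ≠ 0) :
    Q.ord (f * g) = Q.ord f + Q.ord g := by
  unfold ord
  rw [map_mul, WithZero.log_mul (by simpa using hf) (by simpa using hg)]
  ring

theorem le_ord_iff (Q : Place F K) {f : K} (hf : f ≠ 0) (n : ℤ) :
    n ≤ Q.ord f ↔
      (IsDiscreteValuationRing.maximalIdeal Q.regularRing).valuation K f ≤ WithZero.exp (-n) := by
  unfold ord
  rw [le_neg, WithZero.log_le_iff_le_exp (by simpa using hf)]

theorem ord_algebraMap_nonneg (Q : Place F K) (c : F) : 0 ≤ Q.ord (algebraMap F K c) := by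
  rcases eq_or_ne c 0 with rfl | hc
  · simp [ord]
  · rw [le_ord_iff _ (by simpa using hc)]
    simpa using! (IsDiscreteValuationRing.maximalIdeal Q.regularRing).valuation_le_one (K := K)
      (⟨algebraMap F K c, Q.algebraMap_mem c⟩ : Q.regularRing)

theorem le_ord_add (Q : Place F K) {f g : K} (hf : f ≠ 0) (hg : g ≠ 0) (hfg : f + g ≠ 0) {n : ℤ}
    (h₁ : n ≤ Q.ord f) (h₂ : n ≤ Q.ord g) : n ≤ Q.ord (f + g) := by
  rw [le_ord_iff _ hf] at h₁
  rw [le_ord_iff _ hg] at h₂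
  rw [le_ord_iff _ hfg]
  exact Valuation.map_add_le _ h₁ h₂

end Place

/-- Divisors: finite formal integral linear combinations of places. -/
abbrev PlaceDivisor (F K : Type*) [Field F] [Field K] [Algebra F K] : Type _ := Place F K →₀ ℤ

/-- The Riemann–Roch space `L(G) = {f ≠ 0 | (f) + G ≥ 0} ∪ {0}`. -/
noncomputable def riemannRochSpace {F K : Type*} [Field F] [Field K] [Algebra F K]
    (G : PlaceDivisor F K) : Submodule F K where
  carrier := {f | f ≠ 0 ∧ ∀ Q : Place F K, 0 ≤ Q.ord f + G Q} ∪ {0}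
  zero_mem' := Or.inr rfl
  add_mem' := by
    intro f g hf hg
    by_cases hfg : f + g = 0
    · exact Or.inr hfg
    rcases hf with ⟨hf0, hf⟩ | hf
    · rcases hg with ⟨hg0, hg⟩ | hg
      · refine Or.inl ⟨hfg, fun Q => ?_⟩
        have := Q.le_ord_add hf0 hg0 hfg (n := -G Q) (by linarith [hf Q]) (by linarith [hg Q])
        linarith
      · rw [Set.mem_singleton_iff] at hg
        subst hg
        rw [add_zero]
        exact Or.inl ⟨hf0, hf⟩
    · rw [Set.mem_singleton_iff] at hf
      subst hf
      rw [zero_add]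
      exact hg
  smul_mem' := by
    intro c f hf
    by_cases hcf : c • f = 0
    · exact Or.inr hcf
    rcases hf with ⟨hf0, hf⟩ | hf
    · refine Or.inl ⟨hcf, fun Q => ?_⟩
      rw [Algebra.smul_def] at hcf ⊢
      rw [Q.ord_mul (left_ne_zero_of_mul hcf) hf0]
      linarith [hf Q, Q.ord_algebraMap_nonneg c]
    · rw [Set.mem_singleton_iff] at hf
      subst hf
      exact absurd (smul_zero c) hcf

/-- The support of the pole divisor of `f`. -/
def poleSupport {F K : Type*} [Field F] [Field K] [Algebra F K] (f : K) : Set (Place F K) :=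
  {Q | Q.ord f < 0}

/-- `R(Q₁, Q₂)`: the functions that are regular outside `Q₁` and `Q₂`. -/
def regularOutside {F K : Type*} [Field F] [Field K] [Algebra F K] (Q₁ Q₂ : Place F K) : Set K :=
  {f | poleSupport (F := F) f ⊆ {Q₁, Q₂}}

/-- The two-point Weierstrass semigroup `H(Q₁, Q₂)`. -/
def weierstrassSemigroup {F K : Type*} [Field F] [Field K] [Algebra F K] (Q₁ Q₂ : Place F K) :
    Set (ℤ × ℤ) :=
  {n | ∃ f ∈ regularOutside Q₁ Q₂, f ≠ 0 ∧ Q₁.ord f = -n.1 ∧ Q₂.ord f = -n.2}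

/-- `τ_{Q₁,Q₂}(i) = min {j | (i, j) ∈ H(Q₁, Q₂)}`. -/
noncomputable def tau {F K : Type*} [Field F] [Field K] [Algebra F K] (Q₁ Q₂ : Place F K)
    (i : ℤ) : ℤ :=
  sInf {j | (i, j) ∈ weierstrassSemigroup Q₁ Q₂}

/-- `f` is a choice of the function `f^{(i)}_{Q₁,Q₂}`: a nonzero function, regular outside
`Q₁` and `Q₂`, with pole order `i` at `Q₁` and pole order `τ_{Q₁,Q₂}(i)` at `Q₂`. -/
def IsMinimalFunction {F K : Type*} [Field F] [Field K] [Algebra F K] (Q₁ Q₂ : Place F K)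
    (i : ℤ) (f : K) : Prop :=
  f ∈ regularOutside Q₁ Q₂ ∧ f ≠ 0 ∧ Q₁.ord f = -i ∧ Q₂.ord f = -tau Q₁ Q₂ i

/-! Functions with distinct orders at `Q₁` are linearly independent, so the minimal functions are.
They span `L(a₁Q₁ + a₂Q₂)` because `Q₁` is rational: a function of pole order `i` at `Q₁` becomes
one of smaller pole order after subtraction of a constant multiple of the `i`-th minimal function.
The subtraction stays inside the space since `τ(i)` is minimal, and it ends because the space
contains no functions vanishing to high order at `Q₁` (`twoPointSpace_le_span`).

The deeper point is that `τ(i)` exists for every integer `i` (`isLeast_tau`). Boundedness below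
follows from finite dimension. Nonemptiness rests on Riemann's inequality: `i + j - ℓ(iQ₁ + jQ₂)` is
bounded above. Where this integer is maximal, each further step in `i` must raise the dimension, so
all large `i` are pole orders at `Q₁`; powers of a function of the ring that vanishes at `Q₁` then
shift large `i` down to any integer.

For Riemann's inequality, take `t` with simple zeros at `Q₁` and `Q₂` and put `n = [K : F(t)]`. A
basis integral over `F[t⁻¹]`, multiplied by powers of `t⁻¹`, gives about `nl` independent functions
with poles bounded by about `l` times the zeros of `t` (`exists_linearIndependent_bounded`).
Removing the poles away from `Q₁` and `Q₂` costs about `(n - 2)l` dimensions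
(`exists_boundedAt_one_le_sup`), which leaves about `2l`. -/

namespace Place

/-! ### The pole order filtration at a place -/

variable {F K : Type*} [Field F] [Field K] [Algebra F K]

/-- The valuation with values in `ℤᵐ⁰` attached to a place. -/
noncomputable def val (Q : Place F K) : Valuation K (WithZero (Multiplicative ℤ)) :=
  (IsDiscreteValuationRing.maximalIdeal Q.regularRing).valuation K

theorem val_eq_exp (Q : Place F K) {f : K} (hf : f ≠ 0) : Q.val f = WithZero.exp (-Q.ord f) := by
  unfold ord val
  rw [neg_neg, WithZero.exp_log (by simpa using hf)]

theorem val_algebraMap_le_one (Q : Place F K) (c : F) : Q.val (algebraMap F K c) ≤ 1 := by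
  simpa using! (IsDiscreteValuationRing.maximalIdeal Q.regularRing).valuation_le_one (K := K)
    (⟨algebraMap F K c, Q.algebraMap_mem c⟩ : Q.regularRing)

theorem exists_ord_eq (Q : Place F K) (n : ℤ) : ∃ f : K, f ≠ 0 ∧ Q.ord f = n := by
  obtain ⟨π, hπ⟩ := (IsDiscreteValuationRing.maximalIdeal Q.regularRing).valuation_exists_uniformizer
    K
  have h0 : π ≠ 0 := by
    rintro rfl
    rw [map_zero] at hπ
    exact WithZero.exp_ne_zero hπ.symm
  refine ⟨π ^ n, zpow_ne_zero _ h0, ?_⟩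
  unfold ord
  rw [map_zpow₀, hπ, WithZero.log_zpow, WithZero.log_exp]
  simp

/-- The functions whose pole order at `Q` is at most `n`. -/
noncomputable def filt (Q : Place F K) (n : ℤ) : Submodule F K where
  carrier := {f | Q.val f ≤ WithZero.exp n}
  zero_mem' := by simp
  add_mem' := fun hf hg => by
    rw [Set.mem_ofPred_eq] at hf hg ⊢
    exact Valuation.map_add_le _ hf hg
  smul_mem' := fun c f hf => by
    simp only [Set.mem_ofPred_eq, Algebra.smul_def, map_mul] at hf ⊢
    exact mul_le_of_le_one_of_le (Q.val_algebraMap_le_one c) hf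

theorem mem_filt {Q : Place F K} {n : ℤ} {f : K} : f ∈ Q.filt n ↔ Q.val f ≤ WithZero.exp n :=
  Set.mem_ofPred

theorem mem_filt_iff_ord {Q : Place F K} {n : ℤ} {f : K} (hf : f ≠ 0) :
    f ∈ Q.filt n ↔ -n ≤ Q.ord f := by
  rw [mem_filt, val_eq_exp _ hf, WithZero.exp_le_exp]
  omega

theorem filt_mono (Q : Place F K) {m n : ℤ} (h : m ≤ n) : Q.filt m ≤ Q.filt n := fun _ hf =>
  mem_filt.mpr ((mem_filt.mp hf).trans (WithZero.exp_le_exp.mpr h))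

theorem mul_mem_filt {Q : Place F K} {m n : ℤ} {f g : K} (hf : f ∈ Q.filt m) (hg : g ∈ Q.filt n) :
    f * g ∈ Q.filt (m + n) := by
  rw [mem_filt, map_mul, WithZero.exp_add]
  exact mul_le_mul' (mem_filt.mp hf) (mem_filt.mp hg)

theorem one_mem_filt (Q : Place F K) : (1 : K) ∈ Q.filt 0 := by simp [mem_filt]

theorem pow_mem_filt {Q : Place F K} {n : ℤ} {f : K} (hf : f ∈ Q.filt n) (k : ℕ) :
    f ^ k ∈ Q.filt (k * n) := by
  induction k with
  | zero => simpa using Q.one_mem_filt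
  | succ k ih =>
    rw [pow_succ]
    convert mul_mem_filt ih hf using 2
    push_cast
    ring

theorem ord_inv (Q : Place F K) (f : K) : Q.ord f⁻¹ = -Q.ord f := by
  unfold ord
  rw [map_inv₀, WithZero.log_inv]

theorem mem_filt_neg_ord (Q : Place F K) (f : K) : f ∈ Q.filt (-Q.ord f) := by
  rcases eq_or_ne f 0 with rfl | hf
  · exact zero_mem _
  · exact (mem_filt_iff_ord hf).mpr (by simp)

theorem inv_mem_filt_ord (Q : Place F K) (f : K) : f⁻¹ ∈ Q.filt (Q.ord f) := by
  simpa [ord_inv] using Q.mem_filt_neg_ord f⁻¹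

theorem mem_filt_zero_iff {Q : Place F K} {f : K} : f ∈ Q.filt 0 ↔ f ∈ Q.regularRing := by
  rw [mem_filt, WithZero.exp_zero]
  constructor
  · intro h
    obtain ⟨r, hr⟩ := IsDedekindDomain.HeightOneSpectrum.mem_integers_of_valuation_le_one
      (R := Q.regularRing) K f (fun v => by
        have : v = IsDiscreteValuationRing.maximalIdeal Q.regularRing := by
          ext1
          exact IsLocalRing.eq_maximalIdeal (v.isPrime.isMaximal v.ne_bot)
        rw [this]
        exact h)
    rw [← hr]
    exact r.2
  · intro h
    exact (IsDiscreteValuationRing.maximalIdeal Q.regularRing).valuation_le_one (K := K) ⟨f, h⟩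

theorem mem_filt_neg_one_iff {Q : Place F K} (f : Q.regularRing) :
    (f : K) ∈ Q.filt (-1) ↔ f ∈ IsLocalRing.maximalIdeal Q.regularRing := by
  have h : ∀ x : WithZero (Multiplicative ℤ), x ≤ WithZero.exp (-1) ↔ x < 1 := by
    intro x
    rcases eq_or_ne x 0 with rfl | hx
    · simp
    · rw [← WithZero.log_le_iff_le_exp hx, ← WithZero.exp_zero, ← WithZero.log_lt_iff_lt_exp hx]
      omega
  rw [mem_filt, h]
  exact (IsDiscreteValuationRing.maximalIdeal Q.regularRing).valuation_lt_one_iff_mem (K := K) f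

/-- An element of one step of the filtration outside the preceding step has exact pole order. -/
theorem ord_eq_of_mem_of_notMem {Q : Place F K} {n : ℤ} {f : K} (h : f ∈ Q.filt n)
    (h' : f ∉ Q.filt (n - 1)) : f ≠ 0 ∧ Q.ord f = -n := by
  have hf : f ≠ 0 := by
    rintro rfl
    exact h' (zero_mem _)
  rw [mem_filt_iff_ord hf] at h h'
  exact ⟨hf, by omega⟩

/-- At a rational place each step of the pole order filtration has dimension at most one. -/
theorem IsRational.exists_sub_smul_mem {Q : Place F K} (hQ : Q.IsRational) {n : ℤ} {f g : K}
    (hf : f ∈ Q.filt n) (hg0 : g ≠ 0) (hg : Q.ord g = -n) :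
    ∃ c : F, f - c • g ∈ Q.filt (n - 1) := by
  have hfg : f * g⁻¹ ∈ Q.regularRing := by
    rw [← mem_filt_zero_iff]
    have := mul_mem_filt hf (Q.inv_mem_filt_ord g)
    rwa [hg, add_neg_cancel] at this
  -- The residue field is `F`, so the regular function `f / g` has a constant `c` as its value at
  -- `Q`.
  obtain ⟨c, hc⟩ := (finrank_eq_one_iff_of_nonzero' (1 : IsLocalRing.ResidueField Q.regularRing)
    one_ne_zero).mp hQ (IsLocalRing.residue _ ⟨f * g⁻¹, hfg⟩)
  refine ⟨c, ?_⟩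
  have h1 : (⟨f * g⁻¹, hfg⟩ - algebraMap F Q.regularRing c : Q.regularRing) ∈
      IsLocalRing.maximalIdeal Q.regularRing := by
    rw [← Ideal.Quotient.eq_zero_iff_mem, map_sub, sub_eq_zero]
    change IsLocalRing.residue _ _ = IsLocalRing.residue _ _
    rw [← hc, Algebra.smul_def, mul_one]
    rfl
  rw [← mem_filt_neg_one_iff] at h1
  have h2 := mul_mem_filt h1 (Q.mem_filt_neg_ord g)
  rw [hg] at h2
  have h3 : f - c • g = (f * g⁻¹ - algebraMap F K c) * g := by
    rw [Algebra.smul_def]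
    field_simp
  rw [h3, show n - 1 = -1 + - -n by ring]
  exact h2

end Place

/-! ### Finiteness over `F(t)` -/

section FunctionFields

open Polynomial IntermediateField
open scoped IntermediateField.algebraAdjoinAdjoin

/-- `K` is finite over `F(t)` for each `t` that is transcendental over `F`. -/
class FiniteOverTranscendental (F K : Type*) [Field F] [Field K] [Algebra F K] : Prop where
  finiteDimensional : ∀ t : K, Transcendental F t → FiniteDimensional F⟮t⟯ K

/-- Since `K` has transcendence degree one, `t` alone is a transcendence basis; an algebraic
extension that is finitely generated as a field is finite. -/
theorem FunctionField.finiteOverTranscendental (F K : Type*) [Field F] [Field K] [Algebra F K]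
    [Algebra (RatFunc F) K] [IsScalarTower F (RatFunc F) K] [FunctionField F K] :
    FiniteOverTranscendental F K where
  finiteDimensional t ht := by
    have h1 : Algebra.EssFiniteType F[X] (RatFunc F) :=
      .of_isLocalization _ (nonZeroDivisors F[X])
    have h2 : Algebra.EssFiniteType F (RatFunc F) := .comp F F[X] (RatFunc F)
    have h3 : Algebra.EssFiniteType F K := .comp F (RatFunc F) K
    have h4 : Algebra.EssFiniteType F⟮t⟯ K := .of_comp F F⟮t⟯ K
    have h5 : Algebra.IsAlgebraic F[X] (RatFunc F) :=
      IsFractionRing.comap_isAlgebraic_iff (K := RatFunc F).mpr inferInstance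
    have h6 : Algebra.trdeg F (RatFunc F) = 1 := by
      rw [← trdeg_add_eq F F[X], Polynomial.trdeg_of_isDomain, trdeg_eq_zero, add_zero]
    have h7 := lift_trdeg_add_eq F (RatFunc F) K
    rw [h6, trdeg_eq_zero] at h7
    have h8 : AlgebraicIndependent F (fun _ : Unit => t) :=
      algebraicIndependent_unique_type_iff.mpr ht
    have h9 := (h8.isTranscendenceBasis_of_lift_trdeg_le_of_finite (by
      have : Algebra.trdeg F K = 1 := by
        rw [← Cardinal.lift_inj, ← h7]
        simp
      simp [this])).isAlgebraic
    rw [Set.range_const] at h9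
    have h10 : Algebra.IsAlgebraic F⟮t⟯ K :=
      IsFractionRing.comap_isAlgebraic_iff (A := Algebra.adjoin F {t}).mp h9
    exact Algebra.finite_of_essFiniteType_of_isAlgebraic


/-! ### Polynomials in `t` and their valuations -/

variable {F K : Type*} [Field F] [Field K] [Algebra F K]

/-- More than `[K : F(t)]` elements satisfy a linear relation with coefficients in `F[t]`, and the
coefficients can be chosen without a common factor `t`. -/
theorem exists_polynomial_relation {t : K} [FiniteDimensional F⟮t⟯ K]
    {ι : Type*} [Fintype ι] (h : Module.finrank F⟮t⟯ K < Fintype.card ι) (u : ι → K) :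
    ∃ p : ι → F[X], (∃ i, (p i).coeff 0 ≠ 0) ∧ ∑ i, aeval t (p i) * u i = 0 := by
  classical
  have h1 : ¬ LinearIndependent F⟮t⟯ u := fun hu => by
    have := hu.fintype_card_le_finrank
    omega
  rw [← LinearIndependent.iff_fractionRing (R := Algebra.adjoin F {t}),
    Fintype.not_linearIndependent_iff] at h1
  obtain ⟨g, hg, i₀, hi₀⟩ := h1
  have h2 : ∀ i, ∃ q : F[X], aeval t q = (g i : K) := fun i => by
    have : (g i : K) ∈ (aeval (R := F) t).range := by
      rw [← Algebra.adjoin_singleton_eq_range_aeval]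
      exact (g i).2
    exact this
  choose q hq using h2
  let _ : NormalizedGCDMonoid F[X] := Classical.choice inferInstance
  obtain ⟨p, hp, hp1⟩ := Finset.extract_gcd q (s := Finset.univ) ⟨i₀, Finset.mem_univ _⟩
  have hgcd : aeval t (Finset.univ.gcd q) ≠ 0 := by
    intro h0
    refine hi₀ (Subtype.ext ?_)
    rw [← hq, hp i₀ (Finset.mem_univ _), map_mul, h0, zero_mul]
    rfl
  refine ⟨p, ?_, ?_⟩
  · by_contra! hall
    have : (X : F[X]) ∣ Finset.univ.gcd p :=
      Finset.dvd_gcd fun i _ => X_dvd_iff.mpr (hall i)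
    rw [hp1] at this
    exact not_isUnit_X (isUnit_of_dvd_one this)
  · have h3 : aeval t (Finset.univ.gcd q) * ∑ i, aeval t (p i) * u i = 0 := by
      rw [← hg, Finset.mul_sum]
      refine Finset.sum_congr rfl fun i _ => ?_
      rw [← mul_assoc, ← map_mul, ← hp i (Finset.mem_univ _), hq]
      rfl
    exact (mul_eq_zero.mp h3).resolve_left hgcd

variable {Γ : Type*} [LinearOrderedCommGroupWithZero Γ] {v : Valuation K Γ}

theorem Valuation.aeval_le_one (hv : ∀ c : F, v (algebraMap F K c) ≤ 1) {t : K} (ht : v t ≤ 1)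
    (p : F[X]) : v (aeval t p) ≤ 1 := by
  rw [aeval_eq_sum_range]
  refine v.map_sum_le fun i _ => ?_
  rw [Algebra.smul_def, map_mul, map_pow]
  exact mul_le_one' (hv _) (pow_le_one' ht _)

theorem Polynomial.aeval_eq_mul_divX_add (t : K) (p : F[X]) :
    aeval t p = t * aeval t p.divX + algebraMap F K (p.coeff 0) := by
  have := congrArg (aeval t) p.X_mul_divX_add
  rw [map_add, map_mul, aeval_X, aeval_C] at this
  exact this.symm

theorem Valuation.aeval_le_of_coeff_zero (hv : ∀ c : F, v (algebraMap F K c) ≤ 1) {t : K}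
    (ht : v t ≤ 1) {p : F[X]} (hp : p.coeff 0 = 0) : v (aeval t p) ≤ v t := by
  rw [aeval_eq_mul_divX_add, hp, map_zero, add_zero, map_mul]
  exact mul_le_of_le_one_right' (aeval_le_one hv ht _)

/-- A nonzero constant and its inverse both have value at most 1, hence exactly 1; the rest of the
polynomial is a multiple of `t`. -/
theorem Valuation.aeval_eq_one (hv : ∀ c : F, v (algebraMap F K c) ≤ 1) {t : K}
    (ht : v t < 1) {p : F[X]} (hp : p.coeff 0 ≠ 0) : v (aeval t p) = 1 := by
  have h1 : v (algebraMap F K (p.coeff 0)) = 1 := by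
    refine le_antisymm (hv _) ?_
    have h := hv (p.coeff 0)⁻¹
    rw [map_inv₀, map_inv₀] at h
    exact (inv_le_one₀ (by simpa [zero_lt_iff] using hp)).mp h
  rw [aeval_eq_mul_divX_add, add_comm, ← h1]
  refine v.map_add_eq_of_lt_left ?_
  rw [h1, map_mul]
  exact mul_lt_one_of_lt_of_le ht (aeval_le_one hv ht.le _)

/-- A nonzero element of the maximal ideal of a valuation ring over `F` is transcendental. -/
theorem Valuation.transcendental_of_lt_one {Γ : Type*} [LinearOrderedCommGroupWithZero Γ]
    {v : Valuation K Γ} (hv : ∀ c : F, v (algebraMap F K c) ≤ 1) {t : K} (ht : v t < 1)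
    (h0 : t ≠ 0) : Transcendental F t := by
  intro halg
  have h := Valuation.aeval_eq_one hv ht
    (minpoly.coeff_zero_ne_zero (isAlgebraic_iff_isIntegral.mp halg) h0)
  rw [minpoly.aeval, map_zero] at h
  exact zero_ne_one h

/-! ### Existence of places -/

/-- A valuation ring of `K` that contains `F` is noetherian: the length of a chain of proper divisors of an
element `t` of the maximal ideal is bounded by `[K : F(t)]`. -/
theorem ValuationSubring.wfDvdMonoid [hK : FiniteOverTranscendental F K] (V : ValuationSubring K)
    (hV : ∀ c : F, algebraMap F K c ∈ V) : WfDvdMonoid V := by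
  refine ⟨?_⟩
  rw [wellFounded_iff_isEmpty_descending_chain]
  refine ⟨fun ⟨f, hf⟩ => ?_⟩
  have hlt : ∀ i, V.valuation (f (i + 1) : K) > V.valuation (f i : K) := by
    intro i
    obtain ⟨h0, y, hy, hxy⟩ := hf i
    have : V.valuation (y : K) < 1 :=
      (V.valuation_lt_one_iff y).mp ((IsLocalRing.mem_maximalIdeal y).mpr hy)
    rw [hxy, MulMemClass.coe_mul, map_mul]
    exact mul_lt_of_lt_one_right (zero_lt_iff.mpr (by simpa using h0)) this
  have hmono : StrictMono fun i => V.valuation (f i : K) := strictMono_nat_of_lt_succ hlt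
  have h1 : ∀ i, V.valuation (f i : K) < 1 := fun i =>
    (hlt i).trans_le (V.valuation_le_one _)
  -- `f 1` plays the role of `t`, since `f 0` may be zero.
  have h0 : (f 1 : K) ≠ 0 := by
    simpa using (hf 0).1
  have hFV : ∀ c : F, V.valuation (algebraMap F K c) ≤ 1 := fun c =>
    V.valuation_le_one ⟨_, hV c⟩
  have ht := Valuation.transcendental_of_lt_one hFV (h1 1) h0
  have := hK.finiteDimensional _ ht
  set n := Module.finrank F⟮(f 1 : K)⟯ K
  obtain ⟨p, hp, hsum⟩ := exists_polynomial_relation (F := F) (t := (f 1 : K)) (ι := Fin (n + 1))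
    (by simp [n]) (fun i => (f (i + 1) : K))
  -- For the last `j` with nonzero constant coefficient, the `j`-th term strictly dominates: earlier
  -- terms are smaller by monotonicity, and later coefficients are divisible by `t`, whose value is
  -- at most that of `f (j + 1)`. Such a sum cannot vanish.
  obtain ⟨j, hj, hjmax⟩ : ∃ j, (p j).coeff 0 ≠ 0 ∧ ∀ i, j < i → (p i).coeff 0 = 0 := by
    classical
    let s := Finset.univ.filter fun i => (p i).coeff 0 ≠ 0
    have hs : s.Nonempty := hp.imp fun i hi => by simpa [s] using hi
    refine ⟨s.max' hs, by simpa [s] using s.max'_mem hs, fun i hi => ?_⟩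
    by_contra hne
    exact absurd (s.le_max' i (by simpa [s] using hne)) (not_le.mpr hi)
  classical
  rw [← Finset.add_sum_erase _ _ (Finset.mem_univ j)] at hsum
  have hvj : V.valuation (aeval (f 1 : K) (p j) * (f (j + 1) : K)) =
      V.valuation (f (j + 1) : K) := by
    rw [map_mul, Valuation.aeval_eq_one hFV (h1 1) hj, one_mul]
  have hpos : 0 < V.valuation (f (j + 1) : K) := zero_le.trans_lt (hlt j)
  refine absurd (V.valuation.map_sum_lt (s := Finset.univ.erase j)
    (f := fun i => aeval (f 1 : K) (p i) * (f (i + 1) : K)) hpos.ne' ?_) ?_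
  · intro i hi
    rw [map_mul]
    rcases lt_or_gt_of_ne (Finset.ne_of_mem_erase hi) with hij | hij
    · refine (mul_le_of_le_one_left' (Valuation.aeval_le_one hFV (h1 1).le _)).trans_lt ?_
      exact hmono (by simpa using hij)
    · calc _ ≤ V.valuation (f 1 : K) * V.valuation (f (i + 1) : K) := by
            gcongr
            exact Valuation.aeval_le_of_coeff_zero hFV (h1 1).le (hjmax i hij)
        _ < V.valuation (f 1 : K) := mul_lt_of_lt_one_right (zero_lt_iff.mpr (by simpa using h0)) (h1 _)
        _ ≤ _ := hmono.monotone (by omega)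
  · rw [eq_neg_of_add_eq_zero_left hsum, Valuation.map_neg] at hvj
    rw [hvj]
    exact lt_irrefl _

/-- Every transcendental element has a zero. -/
theorem exists_place_ord_pos [FiniteOverTranscendental F K] {t : K} (ht : Transcendental F t) :
    ∃ Q : Place F K, 0 < Q.ord t := by
  have h0 : t ≠ 0 := by
    rintro rfl
    exact ht isAlgebraic_zero
  let t' : (Algebra.adjoin F {t}).toSubring := ⟨t, Algebra.self_mem_adjoin_singleton F t⟩
  have hI : Ideal.span {t'} ≠ ⊤ := by
    rw [Ne, Ideal.span_singleton_eq_top]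
    intro hu
    obtain ⟨⟨s, hs⟩, hts⟩ := isUnit_iff_exists_inv.mp hu
    have hs' : s ∈ (aeval (R := F) t).range := by
      rw [← Algebra.adjoin_singleton_eq_range_aeval]
      exact hs
    obtain ⟨p, rfl⟩ := hs'
    have h1 : aeval t (X * p - 1) = 0 := by
      have := congrArg Subtype.val hts
      simp only [map_sub, map_mul, aeval_X, map_one]
      exact sub_eq_zero.mpr this
    have h2 := (transcendental_iff.mp ht) _ h1
    have h3 := congrArg (fun q => q.coeff 0) h2
    simp at h3
  -- A proper ideal of a subring of `K` is contained in the nonunits of some valuation ring above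
  -- the subring.
  obtain ⟨V, hV, hVt⟩ := Ideal.image_subset_nonunits_valuationSubring _ hI
  have hFV : ∀ c : F, algebraMap F K c ∈ V := fun c =>
    hV ((Algebra.adjoin F {t}).algebraMap_mem c)
  have htV : V.valuation t < 1 := by
    have := hVt ⟨t', Ideal.subset_span rfl, rfl⟩
    exact V.mem_nonunits_iff.mp this
  have htm : t ∈ V := (V.valuation_le_one_iff t).mp htV.le
  have hwf : WfDvdMonoid V := V.wfDvdMonoid hFV
  -- A valuation ring is Bézout, so well-founded divisibility makes it principal.
  have hpid : IsPrincipalIdealRing V := ((IsBezout.TFAE (R := V)).out 3 1).mp hwf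
  have hdvr : IsDiscreteValuationRing V :=
    { not_a_field' := fun hbot => by
        have : (⟨t, htm⟩ : V) ∈ IsLocalRing.maximalIdeal V := (V.valuation_lt_one_iff _).mpr htV
        rw [hbot, Ideal.mem_bot] at this
        exact h0 (congrArg Subtype.val this) }
  let Q : Place F K := ⟨V, hFV, hdvr⟩
  refine ⟨Q, ?_⟩
  have : t ∈ Q.filt (-1) := (Place.mem_filt_neg_one_iff (Q := Q) ⟨t, htm⟩).mpr
    ((V.valuation_lt_one_iff _).mpr htV)
  rw [Place.mem_filt_iff_ord h0] at this
  omega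

/-! ### Weak approximation and independence -/

namespace Place

theorem transcendental_of_ord_pos {Q : Place F K} {t : K} (ht : 0 < Q.ord t) :
    Transcendental F t := by
  have h0 : t ≠ 0 := by
    rintro rfl
    simp [ord] at ht
  refine Valuation.transcendental_of_lt_one (v := Q.val) Q.val_algebraMap_le_one ?_ h0
  rw [val_eq_exp _ h0, ← WithZero.exp_zero, WithZero.exp_lt_exp]
  omega

/-- The absolute value `2 ^ (-ord f)` attached to a place. -/
noncomputable def absValue (Q : Place F K) : AbsoluteValue K ℝ :=
  (IsDiscreteValuationRing.maximalIdeal Q.regularRing).adicAbv (b := 2) one_lt_two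

theorem absValue_eq (Q : Place F K) {f : K} (hf : f ≠ 0) :
    Q.absValue f = (2 : ℝ) ^ (-Q.ord f) := by
  have h : Q.absValue f = WithZeroMulInt.toNNReal (e := 2) two_ne_zero (Q.val f) := rfl
  rw [h, val_eq_exp _ hf, WithZeroMulInt.toNNReal_neg_apply _ WithZero.exp_ne_zero]
  rw [NNReal.coe_zpow]
  congr 1

theorem absValue_le_iff (Q : Place F K) {f : K} {n : ℤ} :
    Q.absValue f ≤ (2 : ℝ) ^ n ↔ f ∈ Q.filt n := by
  rcases eq_or_ne f 0 with rfl | hf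
  · simp [zpow_nonneg]
  · rw [absValue_eq _ hf, mem_filt_iff_ord hf, zpow_le_zpow_iff_right₀ one_lt_two]
    omega

theorem absValue_isNontrivial (Q : Place F K) : Q.absValue.IsNontrivial := by
  obtain ⟨f, hf, hf1⟩ := Q.exists_ord_eq 1
  refine ⟨f, hf, ?_⟩
  rw [absValue_eq _ hf, hf1]
  norm_num

theorem eq_of_absValue_isEquiv {P Q : Place F K} (h : P.absValue.IsEquiv Q.absValue) : P = Q := by
  ext f
  rw [← mem_filt_zero_iff, ← mem_filt_zero_iff, ← absValue_le_iff, ← absValue_le_iff, zpow_zero]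
  exact h.le_one_iff

/-- Weak approximation at finitely many places. -/
theorem exists_sub_mem_filt (S : Finset (Place F K)) (a : Place F K → K) (n : ℤ) :
    ∃ x : K, ∀ Q ∈ S, x - a Q ∈ Q.filt n := by
  have hd := AbsoluteValue.denseRange_algebraMap_pi (v := fun Q : S => Q.1.absValue)
    (fun Q => Q.1.absValue_isNontrivial)
    (fun P Q hPQ h => hPQ (Subtype.ext (eq_of_absValue_isEquiv h)))
  obtain ⟨x, hx⟩ := Metric.denseRange_iff.mp hd
    (fun Q => (WithAbs.equiv Q.1.absValue).symm (a Q.1)) ((2 : ℝ) ^ n) (by positivity)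
  refine ⟨x, fun Q hQ => ?_⟩
  have h := (dist_pi_lt_iff (by positivity)).mp hx ⟨Q, hQ⟩
  rw [dist_comm, dist_eq_norm] at h
  rw [← absValue_le_iff]
  refine le_trans (le_of_eq ?_) h.le
  rfl

/-- An error of order greater than `m` cannot cancel the leading term of `u`. -/
theorem ord_eq_of_sub_mem_filt {Q : Place F K} {x u : K} {m : ℤ} (hu0 : u ≠ 0)
    (hu : Q.ord u = m) (h : x - u ∈ Q.filt (-m - 1)) : x ≠ 0 ∧ Q.ord x = m := by
  have hu1 : u ∈ Q.filt (-m) := (mem_filt_iff_ord hu0).mpr (by omega)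
  have hu2 : u ∉ Q.filt (-m - 1) := fun h => by
    rw [mem_filt_iff_ord hu0] at h
    omega
  have hx1 : x ∈ Q.filt (-m) := by
    simpa using add_mem (Q.filt_mono (by omega) h) hu1
  have hx2 : x ∉ Q.filt (-m - 1) := fun h' => hu2 (by simpa using sub_mem h' h)
  obtain ⟨hx0, hxm⟩ := ord_eq_of_mem_of_notMem hx1 hx2
  exact ⟨hx0, by omega⟩

/-- Weak approximation with a prescribed order at one place. -/
theorem exists_ord_eq_and_mem_filt (S : Finset (Place F K)) (P : Place F K) (m n : ℤ) :
    ∃ x : K, x ≠ 0 ∧ P.ord x = m ∧ ∀ Q ∈ S, Q ≠ P → x ∈ Q.filt n := by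
  classical
  obtain ⟨u, hu0, hu⟩ := P.exists_ord_eq m
  obtain ⟨x, hx⟩ := exists_sub_mem_filt (insert P S) (fun Q => if Q = P then u else 0)
    (min n (-m - 1))
  have hP : x - u ∈ P.filt (-m - 1) := by
    simpa using P.filt_mono (min_le_right _ _) (hx P (Finset.mem_insert_self _ _))
  obtain ⟨hx0, hxm⟩ := ord_eq_of_sub_mem_filt hu0 hu hP
  refine ⟨x, hx0, hxm, fun Q hQ hQP => ?_⟩
  simpa [hQP] using Q.filt_mono (min_le_left _ _) (hx Q (Finset.mem_insert_of_mem hQ))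

/-- The `F`-linear independence of functions with distinct orders at a place. -/
theorem linearIndependent_of_injective_ord (Q : Place F K) {ι : Type*} (f : ι → K)
    (h0 : ∀ i, f i ≠ 0) (hf : Function.Injective fun i => Q.ord (f i)) :
    LinearIndependent F f := by
  classical
  rw [linearIndependent_iff']
  intro s g hg i hi
  by_contra hne
  let s' := s.filter fun i => g i ≠ 0
  -- The term of least order among those with nonzero coefficient cannot be cancelled by the others.
  obtain ⟨j, hj, hjmin⟩ := s'.exists_min_image (fun i => Q.ord (f i)) ⟨i, by simp [s', hi, hne]⟩
  have hj' : j ∈ s ∧ g j ≠ 0 := by simpa [s'] using hj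
  have h1 : g j • f j = -∑ i ∈ s.erase j, g i • f i := by
    rw [eq_neg_iff_add_eq_zero, Finset.add_sum_erase s (fun i => g i • f i) hj'.1, hg]
  have h2 : g j • f j ∈ Q.filt (-Q.ord (f j) - 1) := by
    rw [h1]
    refine neg_mem (sum_mem fun i hi => ?_)
    by_cases hgi : g i = 0
    · rw [hgi, zero_smul]
      exact zero_mem _
    · refine Submodule.smul_mem _ _ ((mem_filt_iff_ord (h0 i)).mpr ?_)
      have hle := hjmin i (by simp [s', Finset.mem_of_mem_erase hi, hgi])
      have hne' : Q.ord (f j) ≠ Q.ord (f i) := fun h => Finset.ne_of_mem_erase hi (hf h).symm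
      omega
  rw [Submodule.smul_mem_iff _ hj'.2, mem_filt_iff_ord (h0 j)] at h2
  omega

end Place

/-! ### Counting zeros by the degree -/

/-- Functions with at most the poles of `t⁻¹` at finitely many zeros of `t`, independent modulo
functions regular at these zeros: there are at most `[K : F(t)]` of them. -/
theorem card_le_finrank_of_independent_mod_regular {t : K} [FiniteDimensional F⟮t⟯ K]
    (S : Finset (Place F K)) (hS : ∀ Q ∈ S, 0 < Q.ord t) (ht : t ≠ 0) {ι : Type*} [Fintype ι]
    (w : ι → K) (hw : ∀ i, ∀ Q ∈ S, w i ∈ Q.filt (Q.ord t))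
    (hind : ∀ c : ι → F, (∀ Q ∈ S, ∑ i, c i • w i ∈ Q.filt 0) → c = 0) :
    Fintype.card ι ≤ Module.finrank F⟮t⟯ K := by
  by_contra! hlt
  obtain ⟨p, ⟨i₀, hi₀⟩, hsum⟩ := exists_polynomial_relation (F := F) (t := t) hlt w
  refine hi₀ (congrFun (hind (fun i => (p i).coeff 0) fun Q hQ => ?_) i₀)
  -- Reducing the relation modulo `t`: the factor `t` cancels the poles of `w i` on `S`, so the
  -- constant coefficients give a combination regular on `S` and must all vanish.
  have h1 : ∑ i, (p i).coeff 0 • w i = -∑ i, aeval t (p i).divX * (t * w i) := by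
    rw [eq_neg_iff_add_eq_zero, ← Finset.sum_add_distrib, ← hsum]
    refine Finset.sum_congr rfl fun i _ => ?_
    rw [aeval_eq_mul_divX_add t (p i), Algebra.smul_def]
    ring
  rw [h1]
  refine neg_mem (sum_mem fun i _ => ?_)
  have h2 : aeval t (p i).divX ∈ Q.filt 0 := by
    rw [Place.mem_filt, WithZero.exp_zero]
    refine Valuation.aeval_le_one Q.val_algebraMap_le_one ?_ _
    rw [← WithZero.exp_zero, ← Place.mem_filt, Place.mem_filt_iff_ord ht]
    have := hS Q hQ
    omega
  simpa using Place.mul_mem_filt h2 (Place.mul_mem_filt (Q.mem_filt_neg_ord t) (hw i Q hQ))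

/-- A nonzero function has finitely many zeros. -/
theorem finite_setOf_ord_pos [hK : FiniteOverTranscendental F K] (t : K) :
    {Q : Place F K | 0 < Q.ord t}.Finite := by
  classical
  by_contra hinf
  obtain ⟨Q₀, hQ₀⟩ := Set.Infinite.nonempty hinf
  have htr := Place.transcendental_of_ord_pos (Set.mem_ofPred.mp hQ₀)
  have ht : t ≠ 0 := by
    rintro rfl
    exact htr isAlgebraic_zero
  have := hK.finiteDimensional t htr
  obtain ⟨S, hS, hcard⟩ := Set.Infinite.exists_subset_card_eq hinf
    (Module.finrank F⟮t⟯ K + 1)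
  have hpos : ∀ Q ∈ S, 0 < Q.ord t := fun Q hQ => Set.mem_ofPred.mp (hS hQ)
  -- One function per zero, with a simple pole there and regular at the other zeros.
  choose w hw0 hw1 hw2 using fun P : S => Place.exists_ord_eq_and_mem_filt S P.1 (-1) 0
  have h := card_le_finrank_of_independent_mod_regular S hpos ht w ?_ ?_
  · rw [Fintype.card_coe] at h
    omega
  · intro P Q hQ
    have := hpos Q hQ
    by_cases hQP : Q = P.1
    · rw [hQP] at this ⊢
      rw [Place.mem_filt_iff_ord (hw0 P), hw1]
      omega
    · exact Q.filt_mono this.le (hw2 P Q hQ hQP)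
  · intro c hc
    funext P
    by_contra hne
    have h1 := hc P.1 P.2
    rw [← Finset.add_sum_erase _ _ (Finset.mem_univ P)] at h1
    have h2 : ∑ i ∈ Finset.univ.erase P, c i • w i ∈ P.1.filt 0 :=
      sum_mem fun i hi => Submodule.smul_mem _ _ (hw2 i P.1 P.2 fun h =>
        Finset.ne_of_mem_erase hi (Subtype.ext h.symm))
    rw [Submodule.add_mem_iff_left _ h2, Submodule.smul_mem_iff _ hne,
      Place.mem_filt_iff_ord (hw0 P), hw1] at h1
    omega

/-! ### Two-point spaces and their finite dimension -/

theorem mem_riemannRochSpace {G : PlaceDivisor F K} {f : K} :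
    f ∈ riemannRochSpace G ↔ ∀ Q : Place F K, f ∈ Q.filt (G Q) := by
  change (f ∈ {f : K | f ≠ 0 ∧ ∀ Q : Place F K, 0 ≤ Q.ord f + G Q} ∪ {0}) ↔ _
  rcases eq_or_ne f 0 with rfl | hf
  · simp
  · simp only [Set.mem_union, Set.mem_ofPred_eq, Set.mem_singleton_iff, hf, or_false, ne_eq,
      not_false_eq_true, true_and, Place.mem_filt_iff_ord hf]
    exact forall_congr' fun Q => by omega

/-- The functions regular outside `Q₁` and `Q₂` with pole orders at most `i` and `j` there. -/
noncomputable def twoPointSpace (Q₁ Q₂ : Place F K) (i j : ℤ) : Submodule F K :=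
  (⨅ (Q : Place F K) (_ : Q ≠ Q₁ ∧ Q ≠ Q₂), Q.filt 0) ⊓ (Q₁.filt i ⊓ Q₂.filt j)

section

variable {Q₁ Q₂ : Place F K} {i j i' j' : ℤ}

theorem mem_twoPointSpace {f : K} : f ∈ twoPointSpace Q₁ Q₂ i j ↔
    (∀ Q : Place F K, Q ≠ Q₁ → Q ≠ Q₂ → f ∈ Q.filt 0) ∧ f ∈ Q₁.filt i ∧ f ∈ Q₂.filt j := by
  simp [twoPointSpace]

theorem twoPointSpace_comm : twoPointSpace Q₁ Q₂ i j = twoPointSpace Q₂ Q₁ j i := by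
  ext f
  simp only [mem_twoPointSpace]
  tauto

theorem twoPointSpace_mono (hi : i ≤ i') (hj : j ≤ j') :
    twoPointSpace Q₁ Q₂ i j ≤ twoPointSpace Q₁ Q₂ i' j' := fun f hf => by
  rw [mem_twoPointSpace] at hf ⊢
  exact ⟨hf.1, Q₁.filt_mono hi hf.2.1, Q₂.filt_mono hj hf.2.2⟩

theorem riemannRochSpace_eq_twoPointSpace (hne : Q₁ ≠ Q₂) (i j : ℤ) :
    riemannRochSpace (Finsupp.single Q₁ i + Finsupp.single Q₂ j) = twoPointSpace Q₁ Q₂ i j := by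
  classical
  ext f
  rw [mem_riemannRochSpace, mem_twoPointSpace]
  constructor
  · intro h
    refine ⟨fun Q h1 h2 => ?_, ?_, ?_⟩
    · simpa [Finsupp.single_apply, h1.symm, h2.symm] using h Q
    · simpa [Finsupp.single_apply, hne.symm] using h Q₁
    · simpa [Finsupp.single_apply, hne] using h Q₂
  · rintro ⟨h, h1, h2⟩ Q
    by_cases hQ1 : Q = Q₁
    · subst hQ1
      simpa [Finsupp.single_apply, hne.symm] using h1
    by_cases hQ2 : Q = Q₂
    · subst hQ2
      simpa [Finsupp.single_apply, hne] using h2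
    simpa [Finsupp.single_apply, Ne.symm hQ1, Ne.symm hQ2] using h Q hQ1 hQ2

theorem mem_regularOutside_iff {f : K} (hf : f ≠ 0) :
    f ∈ regularOutside Q₁ Q₂ ↔ ∀ Q : Place F K, Q ≠ Q₁ → Q ≠ Q₂ → f ∈ Q.filt 0 := by
  change (poleSupport (F := F) f ⊆ {Q₁, Q₂}) ↔ _
  constructor
  · intro h Q h1 h2
    rw [Place.mem_filt_iff_ord hf]
    by_contra hlt
    have := h (show Q ∈ poleSupport f from Set.mem_ofPred.mpr (by omega))
    simp [h1, h2] at this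
  · intro h Q hQ
    by_contra hmem
    simp only [Set.mem_insert_iff, Set.mem_singleton_iff, not_or] at hmem
    have h1 := h Q hmem.1 hmem.2
    rw [Place.mem_filt_iff_ord hf] at h1
    have h2 := Set.mem_ofPred.mp hQ
    omega

theorem mul_mem_twoPointSpace {f g : K} (hf : f ∈ twoPointSpace Q₁ Q₂ i j)
    (hg : g ∈ twoPointSpace Q₁ Q₂ i' j') : f * g ∈ twoPointSpace Q₁ Q₂ (i + i') (j + j') := by
  rw [mem_twoPointSpace] at *
  exact ⟨fun Q h1 h2 => by simpa using Place.mul_mem_filt (hf.1 Q h1 h2) (hg.1 Q h1 h2),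
    Place.mul_mem_filt hf.2.1 hg.2.1, Place.mul_mem_filt hf.2.2 hg.2.2⟩

/-- A function with a zero and no poles vanishes. -/
theorem twoPointSpace_eq_bot [FiniteOverTranscendental F K] :
    twoPointSpace Q₁ Q₂ (-1) 0 = ⊥ := by
  rw [eq_bot_iff]
  intro f hf
  by_contra hf0
  rw [Submodule.mem_bot] at hf0
  rw [mem_twoPointSpace, Place.mem_filt_iff_ord hf0] at hf
  have h1 : Transcendental F f := Place.transcendental_of_ord_pos (Q := Q₁) (by omega)
  -- A zero of `f⁻¹` is a pole of `f`.
  obtain ⟨P, hP⟩ := exists_place_ord_pos (F := F) (t := f⁻¹) (fun h => h1 (by simpa using h.inv))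
  rw [Place.ord_inv] at hP
  have h2 : f ∈ P.filt 0 := by
    by_cases hP1 : P = Q₁
    · rw [hP1, Place.mem_filt_iff_ord hf0]
      omega
    by_cases hP2 : P = Q₂
    · rw [hP2]
      exact hf.2.2
    exact hf.1 P hP1 hP2
  rw [Place.mem_filt_iff_ord hf0] at h2
  omega

/-- By rationality, any one function of exact pole order `i` removes the leading terms of all
others; if there is none, `g = 0` serves. -/
theorem exists_twoPointSpace_le_sup (hQ₁ : Q₁.IsRational) (i j : ℤ) :
    ∃ g : K, twoPointSpace Q₁ Q₂ i j ≤ twoPointSpace Q₁ Q₂ (i - 1) j ⊔ Submodule.span F {g} := by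
  by_cases h : twoPointSpace Q₁ Q₂ i j ≤ Q₁.filt (i - 1)
  · refine ⟨0, fun f hf => Submodule.mem_sup_left ?_⟩
    have h1 := mem_twoPointSpace.mp hf
    exact mem_twoPointSpace.mpr ⟨h1.1, h hf, h1.2.2⟩
  · obtain ⟨g, hg, hg'⟩ := Set.not_subset.mp h
    have h1 := mem_twoPointSpace.mp hg
    obtain ⟨hg0, hord⟩ := Place.ord_eq_of_mem_of_notMem h1.2.1 hg'
    refine ⟨g, fun f hf => ?_⟩
    have h2 := mem_twoPointSpace.mp hf
    obtain ⟨c, hc⟩ := hQ₁.exists_sub_smul_mem h2.2.1 hg0 hord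
    rw [← sub_add_cancel f (c • g)]
    refine Submodule.add_mem_sup ?_ (Submodule.smul_mem _ _ (Submodule.mem_span_singleton_self g))
    have h3 := mem_twoPointSpace.mp (sub_mem hf (Submodule.smul_mem _ c hg))
    exact mem_twoPointSpace.mpr ⟨h3.1, hc, h3.2.2⟩

theorem finite_twoPointSpace_step (hQ₁ : Q₁.IsRational)
    (h : FiniteDimensional F (twoPointSpace Q₁ Q₂ i j)) :
    FiniteDimensional F (twoPointSpace Q₁ Q₂ (i + 1) j) := by
  obtain ⟨g, hg⟩ := exists_twoPointSpace_le_sup (Q₂ := Q₂) hQ₁ (i + 1) j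
  rw [add_sub_cancel_right] at hg
  exact Submodule.finiteDimensional_of_le hg

theorem finite_twoPointSpace_add_nat (hQ₁ : Q₁.IsRational)
    (h : FiniteDimensional F (twoPointSpace Q₁ Q₂ i j)) (k : ℕ) :
    FiniteDimensional F (twoPointSpace Q₁ Q₂ (i + k) j) := by
  induction k with
  | zero => rwa [Nat.cast_zero, add_zero]
  | succ k ih =>
    rw [Nat.cast_succ, ← add_assoc]
    exact finite_twoPointSpace_step hQ₁ ih

/-- Starting from the zero space at `(-1, 0)`, each unit increase of a pole order adds at most one
dimension. -/
theorem finiteDimensional_twoPointSpace [FiniteOverTranscendental F K] (hQ₁ : Q₁.IsRational)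
    (hQ₂ : Q₂.IsRational) (i j : ℤ) : FiniteDimensional F (twoPointSpace Q₁ Q₂ i j) := by
  have h0 : FiniteDimensional F (twoPointSpace Q₁ Q₂ (-1) 0) := by
    rw [twoPointSpace_eq_bot]
    infer_instance
  have h1 := finite_twoPointSpace_add_nat hQ₁ h0 (i + 1).toNat
  rw [twoPointSpace_comm] at h1
  have h2 := finite_twoPointSpace_add_nat hQ₂ h1 j.toNat
  rw [twoPointSpace_comm] at h2
  have hle : twoPointSpace Q₁ Q₂ i j ≤
      twoPointSpace Q₁ Q₂ (-1 + ↑(i + 1).toNat) (0 + ↑j.toNat) :=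
    twoPointSpace_mono (by omega) (by omega)
  exact Submodule.finiteDimensional_of_le hle

theorem finrank_twoPointSpace_le_succ [FiniteOverTranscendental F K] (hQ₁ : Q₁.IsRational)
    (hQ₂ : Q₂.IsRational) (i j : ℤ) :
    Module.finrank F (twoPointSpace Q₁ Q₂ i j) ≤
      Module.finrank F (twoPointSpace Q₁ Q₂ (i - 1) j) + 1 := by
  have := finiteDimensional_twoPointSpace hQ₁ hQ₂ (i - 1) j
  obtain ⟨g, hg⟩ := exists_twoPointSpace_le_sup (Q₂ := Q₂) hQ₁ i j
  refine (Submodule.finrank_mono hg).trans ((Submodule.finrank_add_le_finrank_add_finrank _ _).trans ?_)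
  have := finrank_span_le_card (R := F) ({g} : Set K)
  simp only [Set.toFinset_singleton, Finset.card_singleton] at this
  omega

/-- A finite-dimensional space of functions contains no functions vanishing to high order. -/
theorem Place.exists_inf_filt_eq_bot (Q : Place F K) (W : Submodule F K) [FiniteDimensional F W] :
    ∃ n : ℤ, W ⊓ Q.filt n = ⊥ := by
  induction hd : Module.finrank F W using Nat.strong_induction_on generalizing W with
  | _ d ih =>
    by_cases hW : W = ⊥
    · exact ⟨0, by simp [hW]⟩
    · obtain ⟨f, hf, hf0⟩ := Submodule.exists_mem_ne_zero_of_ne_bot hW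
      have hlt : W ⊓ Q.filt (-Q.ord f - 1) < W := by
        refine lt_of_le_of_ne inf_le_left fun h => ?_
        have : f ∈ Q.filt (-Q.ord f - 1) := (h.ge hf).2
        rw [mem_filt_iff_ord hf0] at this
        omega
      have hfin : FiniteDimensional F ↥(W ⊓ Q.filt (-Q.ord f - 1)) :=
        Submodule.finiteDimensional_of_le inf_le_left
      obtain ⟨n, hn⟩ := ih _ (hd ▸ Submodule.finrank_lt_finrank_of_lt hlt) _ rfl
      refine ⟨min n (-Q.ord f - 1), eq_bot_iff.mpr fun g hg => ?_⟩
      rw [← hn]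
      exact ⟨⟨hg.1, Q.filt_mono (min_le_right _ _) hg.2⟩, Q.filt_mono (min_le_left _ _) hg.2⟩

/-- For `i ≤ 0` all these spaces lie in the finite-dimensional one at `i = 0`. This bounds `tau`
from below and starts the induction in `twoPointSpace_le_span`. -/
theorem exists_twoPointSpace_eq_bot [FiniteOverTranscendental F K] (hQ₁ : Q₁.IsRational)
    (hQ₂ : Q₂.IsRational) (j : ℤ) : ∃ n : ℤ, ∀ i ≤ n, twoPointSpace Q₁ Q₂ i j = ⊥ := by
  have := finiteDimensional_twoPointSpace hQ₁ hQ₂ 0 j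
  obtain ⟨n, hn⟩ := Q₁.exists_inf_filt_eq_bot (twoPointSpace Q₁ Q₂ 0 j)
  refine ⟨min n 0, fun i hi => eq_bot_iff.mpr fun f hf => ?_⟩
  rw [← hn]
  exact ⟨twoPointSpace_mono (by omega) le_rfl hf,
    Q₁.filt_mono (by omega) (mem_twoPointSpace.mp hf).2.1⟩

end

/-! ### Dimension counts modulo a subspace -/

/-- The map from `U` to `M / A` has kernel `U ⊓ A`, and its range lies in the image of `V`. -/
theorem Submodule.finrank_le_finrank_inf_add_finrank {M : Type*} [AddCommGroup M] [Module F M]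
    (U A V : Submodule F M) [FiniteDimensional F U] [FiniteDimensional F V] (h : U ≤ A ⊔ V) :
    Module.finrank F U ≤ Module.finrank F ↥(U ⊓ A) + Module.finrank F V := by
  have h1 := (A.mkQ.domRestrict U).finrank_range_add_finrank_ker
  have h2 : Module.finrank F (A.mkQ.domRestrict U).ker = Module.finrank F ↥(U ⊓ A) := by
    have : (A.mkQ.domRestrict U).ker.map U.subtype = U ⊓ A := by
      ext x
      simp [and_comm]
    rw [← Submodule.finrank_map_subtype_eq, this]
  have h3 : (A.mkQ.domRestrict U).range ≤ V.map A.mkQ := by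
    rintro _ ⟨⟨x, hx⟩, rfl⟩
    obtain ⟨a, ha, v, hv, hav⟩ := Submodule.mem_sup.mp (h hx)
    refine ⟨v, hv, ?_⟩
    simp only [LinearMap.domRestrict_apply, ← hav, map_add]
    simp [(Submodule.Quotient.mk_eq_zero A).mpr ha]
  have h4 := Submodule.finrank_mono h3
  have h5 := Submodule.finrank_map_le A.mkQ V
  omega

/-- If families in `W` that are independent modulo `A` have at most `n` elements, then `W` is
generated modulo `A` by a space of which the dimension is the size of such a family. -/
theorem Submodule.exists_le_sup_of_card_le {M : Type*} [AddCommGroup M] [Module F M]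
    (W A : Submodule F M) (n : ℕ) (h : ∀ (k : ℕ) (s : Fin k → M), (∀ i, s i ∈ W) →
      (∀ c : Fin k → F, ∑ i, c i • s i ∈ A → c = 0) → k ≤ n) :
    ∃ V : Submodule F M, FiniteDimensional F V ∧ Module.finrank F V ≤ n ∧ W ≤ A ⊔ V := by
  have key : ∀ (k : ℕ) (b : Fin k → ↥(W.map A.mkQ)), LinearIndependent F b →
      k ≤ n := by
    intro k b hb
    choose s hsW hs using fun i => (b i).2
    refine h k s hsW fun c hc => ?_
    rw [Fintype.linearIndependent_iff] at hb
    refine funext fun i => hb c ?_ i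
    ext
    rw [← Submodule.Quotient.mk_eq_zero, ← Submodule.mkQ_apply, map_sum] at hc
    simpa [hs] using hc
  have hrank : Module.rank F ↥(W.map A.mkQ) ≤ n := _root_.rank_le fun s hs =>
    key _ _ (hs.comp _ s.equivFin.symm.injective)
  have hfin : FiniteDimensional F ↥(W.map A.mkQ) :=
    Module.rank_lt_aleph0_iff.mp (hrank.trans_lt (Cardinal.natCast_lt_aleph0))
  let b := Module.finBasis F ↥(W.map A.mkQ)
  choose s hsW hs using fun i => (b i).2
  refine ⟨Submodule.span F (Set.range s), .span_of_finite F (Set.finite_range s), ?_, fun f hf => ?_⟩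
  · refine (finrank_range_le_card s).trans ?_
    rw [Fintype.card_fin]
    exact key _ b b.linearIndependent
  · let f' : ↥(W.map A.mkQ) := ⟨A.mkQ f, f, hf, rfl⟩
    have h1 : f - ∑ i, b.repr f' i • s i ∈ A := by
      rw [← Submodule.Quotient.mk_eq_zero, ← Submodule.mkQ_apply, map_sub, map_sum, sub_eq_zero]
      have := congrArg (Submodule.subtype _) (b.sum_repr f')
      simp only [map_sum, map_smul, Submodule.subtype_apply] at this
      simp only [map_smul, hs]
      exact this.symm
    rw [← sub_add_cancel f (∑ i, b.repr f' i • s i)]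
    exact Submodule.add_mem_sup h1 (sum_mem fun i _ =>
      Submodule.smul_mem _ _ (Submodule.subset_span ⟨i, rfl⟩))

/-! ### Riemann's inequality -/

/-- Approximating uniformizers to second order at both places. With simple zeros, the poles of `t ^
(-k)` at `Q₁` and `Q₂` have order exactly `k`. -/
theorem exists_ord_eq_one_and_ord_eq_one {Q₁ Q₂ : Place F K} (hne : Q₁ ≠ Q₂) :
    ∃ t : K, t ≠ 0 ∧ Q₁.ord t = 1 ∧ Q₂.ord t = 1 := by
  classical
  obtain ⟨u₁, h₁, h₁'⟩ := Q₁.exists_ord_eq 1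
  obtain ⟨u₂, h₂, h₂'⟩ := Q₂.exists_ord_eq 1
  obtain ⟨t, ht⟩ := Place.exists_sub_mem_filt {Q₁, Q₂} (fun Q => if Q = Q₁ then u₁ else u₂) (-1 - 1)
  have ht₁ : t - u₁ ∈ Q₁.filt (-1 - 1) := by simpa using ht Q₁ (by simp)
  have ht₂ : t - u₂ ∈ Q₂.filt (-1 - 1) := by simpa [hne.symm] using ht Q₂ (by simp)
  obtain ⟨h0, h1⟩ := Place.ord_eq_of_sub_mem_filt h₁ h₁' ht₁
  exact ⟨t, h0, h1, (Place.ord_eq_of_sub_mem_filt h₂ h₂' ht₂).2⟩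

/-- The functions with at most the poles of `t ^ (-k)` at the places of `S`. -/
noncomputable def boundedAt (S : Finset (Place F K)) (t : K) (k : ℤ) : Submodule F K :=
  ⨅ Q ∈ S, Q.filt (k * Q.ord t)

theorem mem_boundedAt {S : Finset (Place F K)} {t : K} {k : ℤ} {f : K} :
    f ∈ boundedAt S t k ↔ ∀ Q ∈ S, f ∈ Q.filt (k * Q.ord t) := by
  simp [boundedAt]

theorem pow_mul_mem_boundedAt {S : Finset (Place F K)} {t : K} {k : ℤ} {f : K}
    (hf : f ∈ boundedAt S t k) (l : ℕ) : t ^ l * f ∈ boundedAt S t (k - l) := by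
  rw [mem_boundedAt] at *
  intro Q hQ
  convert Place.mul_mem_filt (Place.pow_mem_filt (Q.mem_filt_neg_ord t) l) (hf Q hQ) using 2
  ring

theorem inv_pow_mul_mem_boundedAt {S : Finset (Place F K)} {t : K} {k : ℤ} {f : K}
    (hf : f ∈ boundedAt S t k) (l : ℕ) : t⁻¹ ^ l * f ∈ boundedAt S t (k + l) := by
  rw [mem_boundedAt] at *
  intro Q hQ
  convert Place.mul_mem_filt (Place.pow_mem_filt (Q.inv_mem_filt_ord t) l) (hf Q hQ) using 2
  ring

/-- The simple zeros `Q₁` and `Q₂` of `t` account for two of the dimensions available. -/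
theorem exists_boundedAt_one_le_sup {t : K} [FiniteDimensional F⟮t⟯ K] (ht : t ≠ 0)
    {Q₁ Q₂ : Place F K} (hne : Q₁ ≠ Q₂) (h₁ : Q₁.ord t = 1) (h₂ : Q₂.ord t = 1)
    (S : Finset (Place F K)) (hS : ∀ Q ∈ S, 0 < Q.ord t) (hS₁ : Q₁ ∉ S) (hS₂ : Q₂ ∉ S) :
    ∃ V : Submodule F K, FiniteDimensional F V ∧
      Module.finrank F V + 2 ≤ Module.finrank F⟮t⟯ K ∧ boundedAt S t 1 ≤ boundedAt S t 0 ⊔ V := by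
  classical
  have key : ∀ (k : ℕ) (s : Fin k → K), (∀ i, s i ∈ boundedAt S t 1) →
      (∀ c : Fin k → F, ∑ i, c i • s i ∈ boundedAt S t 0 → c = 0) →
      k + 2 ≤ Module.finrank F⟮t⟯ K := by
    intro k s hs hind
    choose a ha using fun i => Place.exists_sub_mem_filt (insert Q₁ (insert Q₂ S))
      (fun Q => if Q ∈ S then s i else 0) 0
    have haS : ∀ i, ∀ Q ∈ S, a i - s i ∈ Q.filt 0 := fun i Q hQ => by
      simpa [hQ] using ha i Q (by simp [hQ])
    have ha₁ : ∀ i, a i ∈ Q₁.filt 0 := fun i => by simpa [hS₁] using ha i Q₁ (by simp)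
    have ha₂ : ∀ i, a i ∈ Q₂.filt 0 := fun i => by simpa [hS₂] using ha i Q₂ (by simp)
    -- The `a i` have the polar parts of the `s i` on `S` and none at `Q₁`, `Q₂`. Adjoining `b₁` and
    -- `b₂`, with simple poles at these two places, yields `k + 2` functions independent modulo
    -- regular ones.
    obtain ⟨b₁, hb₁0, hb₁, hb₁'⟩ :=
      Place.exists_ord_eq_and_mem_filt (insert Q₁ (insert Q₂ S)) Q₁ (-1) 0
    obtain ⟨b₂, hb₂0, hb₂, hb₂'⟩ :=
      Place.exists_ord_eq_and_mem_filt (insert Q₁ (insert Q₂ S)) Q₂ (-1) 0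
    have hb₁₂ : b₁ ∈ Q₂.filt 0 := hb₁' Q₂ (by simp) hne.symm
    have hb₂₁ : b₂ ∈ Q₁.filt 0 := hb₂' Q₁ (by simp) hne
    have hb₁S : ∀ Q ∈ S, b₁ ∈ Q.filt 0 := fun Q hQ =>
      hb₁' Q (by simp [hQ]) (by rintro rfl; exact hS₁ hQ)
    have hb₂S : ∀ Q ∈ S, b₂ ∈ Q.filt 0 := fun Q hQ =>
      hb₂' Q (by simp [hQ]) (by rintro rfl; exact hS₂ hQ)
    have hb₁₁ : b₁ ∉ Q₁.filt 0 := by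
      rw [Place.mem_filt_iff_ord hb₁0, hb₁]
      omega
    have hb₂₂ : b₂ ∉ Q₂.filt 0 := by
      rw [Place.mem_filt_iff_ord hb₂0, hb₂]
      omega
    have hcard := card_le_finrank_of_independent_mod_regular (t := t) (insert Q₁ (insert Q₂ S))
      (by simpa [h₁, h₂] using hS) ht (Sum.elim a fun b : Bool => if b then b₁ else b₂) ?_ ?_
    · simpa using hcard
    · rintro (i | b) Q hQ
      · simp only [Finset.mem_insert] at hQ
        rcases hQ with rfl | rfl | hQ
        · exact Q.filt_mono (by omega) (ha₁ i)
        · exact Q.filt_mono (by omega) (ha₂ i)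
        · have h1 := add_mem (Q.filt_mono (hS Q hQ).le (haS i Q hQ))
            (one_mul (Q.ord t) ▸ mem_boundedAt.mp (hs i) Q hQ)
          simpa using h1
      · have h1 : b₁ ∈ Q.filt (Q.ord t) := by
          by_cases hQ1 : Q = Q₁
          · rw [hQ1, Place.mem_filt_iff_ord hb₁0]
            omega
          · refine Q.filt_mono ?_ (hb₁' Q hQ hQ1)
            simp only [Finset.mem_insert] at hQ
            rcases hQ with rfl | rfl | hQ
            · omega
            · omega
            · exact (hS Q hQ).le
        have h2 : b₂ ∈ Q.filt (Q.ord t) := by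
          by_cases hQ2 : Q = Q₂
          · rw [hQ2, Place.mem_filt_iff_ord hb₂0]
            omega
          · refine Q.filt_mono ?_ (hb₂' Q hQ hQ2)
            simp only [Finset.mem_insert] at hQ
            rcases hQ with rfl | rfl | hQ
            · omega
            · omega
            · exact (hS Q hQ).le
        cases b
        · exact h2
        · exact h1
    · intro c hc
      simp only [Fintype.sum_sum_type, Sum.elim_inl, Sum.elim_inr, Fintype.sum_bool, if_true,
        Bool.false_eq_true, if_false] at hc
      have hsum : ∀ Q : Place F K, (∀ i, a i ∈ Q.filt 0) → ∑ i, c (Sum.inl i) • a i ∈ Q.filt 0 :=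
        fun Q hQ => sum_mem fun i _ => Submodule.smul_mem _ _ (hQ i)
      have hc₁ : c (Sum.inr true) = 0 := by
        by_contra hne0
        have := hc Q₁ (by simp)
        rw [Submodule.add_mem_iff_right _ (hsum Q₁ ha₁),
          Submodule.add_mem_iff_left _ (Submodule.smul_mem _ _ hb₂₁),
          Submodule.smul_mem_iff _ hne0] at this
        exact hb₁₁ this
      have hc₂ : c (Sum.inr false) = 0 := by
        by_contra hne0
        have := hc Q₂ (by simp)
        rw [Submodule.add_mem_iff_right _ (hsum Q₂ ha₂),
          Submodule.add_mem_iff_right _ (Submodule.smul_mem _ _ hb₁₂),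
          Submodule.smul_mem_iff _ hne0] at this
        exact hb₂₂ this
      have hc₀ : (fun i => c (Sum.inl i)) = 0 := by
        refine hind _ (mem_boundedAt.mpr fun Q hQ => ?_)
        have h1 := hc Q (by simp [hQ])
        rw [hc₁, hc₂, zero_smul, zero_smul, add_zero, add_zero] at h1
        have h2 : ∑ i, c (Sum.inl i) • (a i - s i) ∈ Q.filt 0 :=
          sum_mem fun i _ => Submodule.smul_mem _ _ (haS i Q hQ)
        have h3 := sub_mem h1 h2
        simp only [smul_sub, Finset.sum_sub_distrib, sub_sub_cancel] at h3
        simpa using h3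
      funext x
      rcases x with i | b
      · exact congrFun hc₀ i
      · cases b
        · exact hc₂
        · exact hc₁
  -- The empty family shows that the subtraction `n - 2` below does not truncate.
  have hn : 2 ≤ Module.finrank F⟮t⟯ K := by
    simpa using key 0 Fin.elim0 (fun i => i.elim0) (fun c _ => Subsingleton.elim _ _)
  obtain ⟨V, hV, hV1, hV2⟩ := Submodule.exists_le_sup_of_card_le (boundedAt S t 1)
    (boundedAt S t 0) (Module.finrank F⟮t⟯ K - 2) fun k s h1 h2 => by
      have := key k s h1 h2
      omega
  exact ⟨V, hV, by omega, hV2⟩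

/-- Multiplication by `t ^ l` reduces level `l + 1` to level 1, where `V` absorbs the poles;
multiplying back leaves a remainder of level `l`. Each level thus costs at most `dim V`. -/
theorem exists_boundedAt_le_sup {t : K} (ht : t ≠ 0) {S : Finset (Place F K)}
    {V : Submodule F K} [FiniteDimensional F V] (hV : boundedAt S t 1 ≤ boundedAt S t 0 ⊔ V)
    (l : ℕ) : ∃ W : Submodule F K, FiniteDimensional F W ∧
      Module.finrank F W ≤ l * Module.finrank F V ∧ boundedAt S t l ≤ boundedAt S t 0 ⊔ W := by
  induction l with
  | zero => exact ⟨⊥, inferInstance, by simp, by simp⟩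
  | succ l ih =>
    obtain ⟨W, hW, hW1, hW2⟩ := ih
    refine ⟨W ⊔ V.map (LinearMap.mulLeft F (t⁻¹ ^ l)), inferInstance, ?_, fun f hf => ?_⟩
    · have h1 := Submodule.finrank_add_le_finrank_add_finrank W (V.map (LinearMap.mulLeft F (t⁻¹ ^ l)))
      have h2 := Submodule.finrank_map_le (LinearMap.mulLeft F (t⁻¹ ^ l)) V
      rw [add_mul, one_mul]
      omega
    · have h1 := pow_mul_mem_boundedAt hf l
      rw [Nat.cast_succ, add_sub_cancel_left] at h1
      obtain ⟨a, ha, v, hv, hav⟩ := Submodule.mem_sup.mp (hV h1)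
      have h2 : f = t⁻¹ ^ l * a + t⁻¹ ^ l * v := by
        rw [← mul_add, hav, ← mul_assoc, ← mul_pow, inv_mul_cancel₀ ht, one_pow, one_mul]
      have h3 := inv_pow_mul_mem_boundedAt ha l
      rw [zero_add] at h3
      rw [h2, ← sup_assoc]
      exact Submodule.add_mem_sup (hW2 h3) ⟨v, hv, rfl⟩

/-- The valuation ring contains `F[x]` and is integrally closed. -/
theorem Place.mem_filt_zero_of_isIntegral {Q : Place F K} {x b : K} (hx : x ∈ Q.filt 0)
    (hb : IsIntegral (Algebra.adjoin F {x}) b) : b ∈ Q.filt 0 := by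
  have hA : ∀ y ∈ Algebra.adjoin F {x}, y ∈ Q.regularRing := by
    intro y hy
    induction hy using Algebra.adjoin_induction with
    | mem y hy =>
      rw [Set.mem_singleton_iff] at hy
      rw [hy]
      exact mem_filt_zero_iff.mp hx
    | algebraMap c => exact Q.algebraMap_mem c
    | add y z _ _ hy hz => exact add_mem hy hz
    | mul y z _ _ hy hz => exact mul_mem hy hz
  let φ : Algebra.adjoin F {x} →+* Q.regularRing :=
    (algebraMap (Algebra.adjoin F {x}) K).codRestrict Q.regularRing fun y => hA y y.2
  obtain ⟨p, hp, hpb⟩ := hb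
  have hint : IsIntegral Q.regularRing b := by
    refine ⟨p.map φ, hp.map φ, ?_⟩
    rw [Polynomial.eval₂_map]
    exact hpb
  obtain ⟨y, hy⟩ := IsIntegrallyClosed.isIntegral_iff.mp hint
  rw [mem_filt_zero_iff, ← hy]
  exact y.2

theorem IntermediateField.adjoin_simple_inv_eq (t : K) : F⟮t⁻¹⟯ = F⟮t⟯ := by
  refine le_antisymm ?_ ?_
  · rw [adjoin_simple_le_iff]
    exact inv_mem (mem_adjoin_simple_self F t)
  · rw [adjoin_simple_le_iff]
    simpa using inv_mem (mem_adjoin_simple_self F t⁻¹)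

/-- The multiples of the zero divisor of `t` admit spaces of functions of the expected
dimension, up to a constant. -/
theorem exists_linearIndependent_bounded [hK : FiniteOverTranscendental F K] {t : K}
    (ht : Transcendental F t) : ∃ k : ℕ, ∀ l : ℕ,
      ∃ w : Fin (Module.finrank F⟮t⟯ K * (l + 1)) → K, LinearIndependent F w ∧
        ∀ i, ∀ Q : Place F K, (0 < Q.ord t → w i ∈ Q.filt ((k + l : ℕ) * Q.ord t)) ∧
          (Q.ord t ≤ 0 → w i ∈ Q.filt 0) := by
  have ht0 : t ≠ 0 := by
    rintro rfl
    exact ht isAlgebraic_zero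
  have hfin : FiniteDimensional F⟮t⁻¹⟯ K :=
    hK.finiteDimensional _ (fun h => ht (by simpa using h.inv))
  have hrank : Module.finrank F⟮t⁻¹⟯ K = Module.finrank F⟮t⟯ K := by
    rw [adjoin_simple_inv_eq]
  rw [← hrank]
  obtain ⟨s, b, hb⟩ := FiniteDimensional.exists_is_basis_integral
    (Algebra.adjoin F {t⁻¹}) F⟮t⁻¹⟯ K
  have hbreg : ∀ i, ∀ Q : Place F K, Q.ord t ≤ 0 → b i ∈ Q.filt 0 := fun i Q hQ =>
    Place.mem_filt_zero_of_isIntegral (Q.filt_mono hQ (Q.inv_mem_filt_ord t)) (hb i)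
  have hk : ∃ k : ℕ, ∀ i, ∀ Q : Place F K, 0 < Q.ord t → -Q.ord (b i) ≤ k := by
    let T := (finite_setOf_ord_pos (F := F) t).toFinset
    -- A crude uniform bound: the sum of all pole orders of basis elements at the finitely many
    -- zeros of `t`.
    refine ⟨∑ p ∈ Finset.univ ×ˢ T, (-p.2.ord (b p.1)).toNat, fun i Q hQ => ?_⟩
    have h1 : (i, Q) ∈ (Finset.univ : Finset s) ×ˢ T := by simp [T, hQ]
    have h2 := Finset.single_le_sum (f := fun p : s × Place F K => (-p.2.ord (b p.1)).toNat)
      (fun _ _ => Nat.zero_le _) h1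
    have h3 := Int.self_le_toNat (-Q.ord (b i))
    dsimp only at h2
    omega
  obtain ⟨k, hk⟩ := hk
  refine ⟨k, fun l => ?_⟩
  obtain ⟨Q₀, hQ₀⟩ := exists_place_ord_pos ht
  -- The powers of `t⁻¹` have distinct orders at a zero `Q₀` of `t`.
  have hpow : LinearIndependent F fun j : Fin (l + 1) => AdjoinSimple.gen F t⁻¹ ^ (j : ℕ) := by
    refine LinearIndependent.of_comp F⟮t⁻¹⟯.val.toLinearMap ?_
    refine Q₀.linearIndependent_of_injective_ord _ (fun j => ?_) fun i j hij => ?_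
    · simp [ht0]
    · have hord : ∀ m : ℕ, Q₀.ord (t⁻¹ ^ m) = -(m * Q₀.ord t) := fun m => by
        unfold Place.ord
        rw [map_pow, map_inv₀, WithZero.log_pow, WithZero.log_inv]
        simp
      simp only [Function.comp_apply, AlgHom.toLinearMap_apply, map_pow, coe_val,
        AdjoinSimple.coe_gen, hord, neg_inj] at hij
      exact Fin.ext (by exact_mod_cast mul_right_cancel₀ hQ₀.ne' hij)
  have hli := linearIndependent_smul hpow b.linearIndependent
  have hcard : Fintype.card (Fin (l + 1) × s) = Module.finrank F⟮t⁻¹⟯ K * (l + 1) := by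
    rw [Fintype.card_prod, Fintype.card_fin, Module.finrank_eq_card_basis b, mul_comm]
  let e := (Fintype.equivFinOfCardEq hcard).symm
  refine ⟨_, hli.comp e e.injective, fun i Q => ?_⟩
  obtain ⟨⟨j, m⟩, hjm⟩ : ∃ p, e i = p := ⟨_, rfl⟩
  have hval : ((fun p : Fin (l + 1) × s => AdjoinSimple.gen F t⁻¹ ^ (p.1 : ℕ) • b p.2) ∘ e) i =
      t⁻¹ ^ (j : ℕ) * b m := by
    rw [Function.comp_apply, hjm]
    rfl
  rw [hval]
  have h1 := Place.pow_mem_filt (Q.inv_mem_filt_ord t) j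
  constructor
  · intro hQ
    have h2 := Place.mul_mem_filt h1 (Q.mem_filt_neg_ord (b m))
    -- Here `Q.ord t ≥ 1`, so the bound `k` is at most `k * Q.ord t`.
    refine Q.filt_mono ?_ h2
    have h3 := hk m Q hQ
    have h4 : (j : ℤ) ≤ l := by exact_mod_cast Nat.lt_succ_iff.mp j.2
    push_cast
    nlinarith
  · intro hQ
    have h2 := Place.mul_mem_filt h1 (hbreg m Q hQ)
    refine Q.filt_mono ?_ h2
    have : (0 : ℤ) ≤ j := by positivity
    nlinarith

/-- Riemann's inequality on the divisors `i Q₁ + j Q₂`. -/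
theorem exists_le_finrank_twoPointSpace_add [hK : FiniteOverTranscendental F K]
    {Q₁ Q₂ : Place F K} (hne : Q₁ ≠ Q₂) (hQ₁ : Q₁.IsRational) (hQ₂ : Q₂.IsRational) :
    ∃ C : ℤ, ∀ m : ℕ, ∃ m' ≥ m, 2 * (m' : ℤ) ≤
      Module.finrank F (twoPointSpace Q₁ Q₂ (m' : ℤ) (m' : ℤ)) + C := by
  classical
  obtain ⟨t, ht0, h₁, h₂⟩ := exists_ord_eq_one_and_ord_eq_one hne
  have ht : Transcendental F t := Place.transcendental_of_ord_pos (Q := Q₁) (by omega)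
  have := hK.finiteDimensional t ht
  obtain ⟨k, hk⟩ := exists_linearIndependent_bounded ht
  let T := (finite_setOf_ord_pos (F := F) t).toFinset
  have hT : ∀ Q, Q ∈ T ↔ 0 < Q.ord t := fun Q => by simp [T]
  let S := (T.erase Q₁).erase Q₂
  have hS : ∀ Q, Q ∈ S ↔ Q ≠ Q₂ ∧ Q ≠ Q₁ ∧ 0 < Q.ord t := fun Q => by simp [S, hT]
  obtain ⟨V, hV, hVn, hV1⟩ := exists_boundedAt_one_le_sup ht0 hne h₁ h₂ S
    (fun Q hQ => ((hS Q).mp hQ).2.2) (by simp [hS]) (by simp [hS])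
  set n := Module.finrank F⟮t⟯ K
  -- The count is `n(l + 1) - (n - 2)(k + l) = 2(k + l) + n - nk`, so `nk` suffices as the constant.
  refine ⟨n * k, fun l => ⟨k + l, by omega, ?_⟩⟩
  obtain ⟨w, hw, hwQ⟩ := hk l
  obtain ⟨W, hW, hWd, hW1⟩ := exists_boundedAt_le_sup ht0 hV1 (k + l)
  let U := Submodule.span F (Set.range w)
  have hUfin : FiniteDimensional F U := .span_of_finite F (Set.finite_range w)
  have hU : Module.finrank F U = n * (l + 1) := by
    rw [finrank_span_eq_card hw, Fintype.card_fin]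
  have hUW : U ≤ boundedAt S t 0 ⊔ W := by
    refine le_trans (Submodule.span_le.mpr ?_) hW1
    rintro _ ⟨i, rfl⟩
    exact mem_boundedAt.mpr fun Q hQ => (hwQ i Q).1 ((hS Q).mp hQ).2.2
  -- Once regular on `S`, an element of `U` can only have poles at `Q₁` and `Q₂`.
  have hUL : U ⊓ boundedAt S t 0 ≤ twoPointSpace Q₁ Q₂ (k + l : ℕ) (k + l : ℕ) := by
    rintro f ⟨hfU, hf⟩
    have hspan : ∀ (Q : Place F K) (m : ℤ), (∀ i, w i ∈ Q.filt m) → f ∈ Q.filt m :=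
      fun Q m h => (Submodule.span_le.mpr (by rintro _ ⟨i, rfl⟩; exact h i) : U ≤ Q.filt m) hfU
    refine mem_twoPointSpace.mpr ⟨fun Q hQ1 hQ2 => ?_, ?_, ?_⟩
    · by_cases hQ : 0 < Q.ord t
      · simpa using mem_boundedAt.mp hf Q ((hS Q).mpr ⟨hQ2, hQ1, hQ⟩)
      · exact hspan Q 0 fun i => (hwQ i Q).2 (not_lt.mp hQ)
    · refine hspan _ _ fun i => ?_
      simpa [h₁] using (hwQ i Q₁).1 (by omega)
    · refine hspan _ _ fun i => ?_
      simpa [h₂] using (hwQ i Q₂).1 (by omega)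
  have hfin := finiteDimensional_twoPointSpace hQ₁ hQ₂ (k + l : ℕ) (k + l : ℕ)
  have h3 := Submodule.finrank_le_finrank_inf_add_finrank U _ W hUW
  have h4 := Submodule.finrank_mono hUL
  rw [hU] at h3
  have h5 : n * (l + 1) ≤
      Module.finrank F (twoPointSpace Q₁ Q₂ ((k + l : ℕ) : ℤ) ((k + l : ℕ) : ℤ)) +
        (k + l) * Module.finrank F V := by omega
  have h6 : ((n * (l + 1) : ℕ) : ℤ) ≤
      (Module.finrank F (twoPointSpace Q₁ Q₂ ((k + l : ℕ) : ℤ) ((k + l : ℕ) : ℤ)) +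
        (k + l) * Module.finrank F V : ℕ) := by exact_mod_cast h5
  have h7 : (Module.finrank F V : ℤ) + 2 ≤ n := by exact_mod_cast hVn
  push_cast at h6 ⊢
  nlinarith [mul_le_mul_of_nonneg_left h7 (by positivity : (0 : ℤ) ≤ k + l)]

/-! ### Existence of `tau` and spanning by minimal functions -/

section

variable {Q₁ Q₂ : Place F K}

theorem IsMinimalFunction.mem_twoPointSpace {i a b : ℤ} {f : K}
    (h : IsMinimalFunction Q₁ Q₂ i f) (hi : i ≤ a) (hb : tau Q₁ Q₂ i ≤ b) :
    f ∈ twoPointSpace Q₁ Q₂ a b := by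
  obtain ⟨hf, hf0, h1, h2⟩ := h
  exact _root_.mem_twoPointSpace.mpr ⟨(mem_regularOutside_iff hf0).mp hf,
    (Place.mem_filt_iff_ord hf0).mpr (by omega), (Place.mem_filt_iff_ord hf0).mpr (by omega)⟩

theorem linearIndependent_isMinimalFunction {f : ℤ → K}
    (hf : ∀ i, IsMinimalFunction Q₁ Q₂ i (f i)) : LinearIndependent F f :=
  Q₁.linearIndependent_of_injective_ord f (fun i => (hf i).2.1) fun i j hij => by
    simp only [(hf i).2.2.1, (hf j).2.2.1] at hij
    omega

variable [FiniteOverTranscendental F K]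

theorem finrank_twoPointSpace_le_add (hQ₁ : Q₁.IsRational) (hQ₂ : Q₂.IsRational)
    (i j : ℤ) (k l : ℕ) : Module.finrank F (twoPointSpace Q₁ Q₂ (i + k) (j + l)) ≤
      Module.finrank F (twoPointSpace Q₁ Q₂ i j) + k + l := by
  have key : ∀ {P Q : Place F K}, P.IsRational → Q.IsRational → ∀ (i j : ℤ) (k : ℕ),
      Module.finrank F (twoPointSpace P Q (i + k) j) ≤
        Module.finrank F (twoPointSpace P Q i j) + k := by
    intro P Q hP hQ i j k
    induction k with
    | zero => rw [Nat.cast_zero, add_zero, add_zero]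
    | succ k ih =>
      have h := finrank_twoPointSpace_le_succ hP hQ (i + (k + 1 : ℕ)) j
      rw [Nat.cast_succ, ← add_assoc, add_sub_cancel_right] at h
      rw [Nat.cast_succ, ← add_assoc]
      omega
  have h1 := key hQ₁ hQ₂ i (j + l) k
  have h2 := key hQ₂ hQ₁ j i l
  rw [twoPointSpace_comm, twoPointSpace_comm (i := j)] at h2
  omega

/-- The quantity `i + j - dim` never decreases when `i` or `j` grows, so bounding it at arbitrarily
large diagonal points bounds it everywhere. -/
theorem exists_le_finrank_twoPointSpace (hne : Q₁ ≠ Q₂) (hQ₁ : Q₁.IsRational)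
    (hQ₂ : Q₂.IsRational) :
    ∃ C : ℤ, ∀ i j : ℤ, i + j - Module.finrank F (twoPointSpace Q₁ Q₂ i j) ≤ C := by
  obtain ⟨C, hC⟩ := exists_le_finrank_twoPointSpace_add hne hQ₁ hQ₂
  refine ⟨C, fun i j => ?_⟩
  obtain ⟨m, hm, h⟩ := hC (max i.toNat j.toNat)
  have h1 := finrank_twoPointSpace_le_add hQ₁ hQ₂ i j (m - i).toNat (m - j).toNat
  rw [show i + ((m - i).toNat : ℤ) = m by omega, show j + ((m - j).toNat : ℤ) = m by omega] at h1
  omega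

/-- For large `i` some function of the two-point ring has pole order `i` at `Q₁`. -/
theorem exists_forall_gt_ord_eq (hne : Q₁ ≠ Q₂) (hQ₁ : Q₁.IsRational) (hQ₂ : Q₂.IsRational) :
    ∃ i₀ : ℤ, ∀ i > i₀, ∃ j : ℤ, ∃ f ∈ twoPointSpace Q₁ Q₂ i j, f ≠ 0 ∧ Q₁.ord f = -i := by
  obtain ⟨C, hC⟩ := exists_le_finrank_twoPointSpace hne hQ₁ hQ₂
  -- Past a maximum of `i + j - dim`, a step in `i` that left the dimension unchanged would exceed
  -- the maximum.
  obtain ⟨M, ⟨i₀, j₀, hM⟩, hmax⟩ := Int.exists_greatest_of_bdd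
    (P := fun M => ∃ i j : ℤ, i + j - Module.finrank F (twoPointSpace Q₁ Q₂ i j) = M)
    ⟨C, fun M ⟨i, j, h⟩ => h ▸ hC i j⟩ ⟨_, 0, 0, rfl⟩
  refine ⟨i₀, fun i hi => ⟨j₀, ?_⟩⟩
  by_contra! hno
  have hle : twoPointSpace Q₁ Q₂ i j₀ ≤ twoPointSpace Q₁ Q₂ (i - 1) j₀ := by
    intro f hf
    have h1 := mem_twoPointSpace.mp hf
    refine mem_twoPointSpace.mpr ⟨h1.1, ?_, h1.2.2⟩
    by_contra hnot
    obtain ⟨hf0, hord⟩ := Place.ord_eq_of_mem_of_notMem h1.2.1 hnot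
    exact hno f hf hf0 hord
  have := finiteDimensional_twoPointSpace hQ₁ hQ₂ (i - 1) j₀
  have h2 := Submodule.finrank_mono hle
  have h3 := finrank_twoPointSpace_le_add hQ₁ hQ₂ i₀ j₀ (i - 1 - i₀).toNat 0
  rw [show i₀ + ((i - 1 - i₀).toNat : ℤ) = i - 1 by omega, Nat.cast_zero, add_zero] at h3
  have h4 := hmax _ ⟨i, j₀, rfl⟩
  omega

theorem exists_ne_zero_mem_twoPointSpace (hne : Q₁ ≠ Q₂) (hQ₁ : Q₁.IsRational)
    (hQ₂ : Q₂.IsRational) (i : ℤ) : ∃ j : ℤ, ∃ f ∈ twoPointSpace Q₁ Q₂ i j, f ≠ 0 := by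
  obtain ⟨C, hC⟩ := exists_le_finrank_twoPointSpace hne hQ₁ hQ₂
  -- This `j` makes `i + j = C + 1`, which forces dimension at least one.
  have h := hC i (C - i + 1)
  refine ⟨C - i + 1, Submodule.exists_mem_ne_zero_of_ne_bot fun hbot => ?_⟩
  rw [hbot, finrank_bot] at h
  omega

/-- Every integer is the pole order at `Q₁` of a function of the two-point ring. -/
theorem exists_mem_twoPointSpace_ord_eq (hne : Q₁ ≠ Q₂) (hQ₁ : Q₁.IsRational)
    (hQ₂ : Q₂.IsRational) (i : ℤ) :
    ∃ j : ℤ, ∃ f ∈ twoPointSpace Q₁ Q₂ i j, f ≠ 0 ∧ Q₁.ord f = -i := by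
  obtain ⟨i₀, hi₀⟩ := exists_forall_gt_ord_eq hne hQ₁ hQ₂
  -- Since `g` vanishes at `Q₁`, its powers lower pole orders there by arbitrarily large `m`.
  obtain ⟨j, g, hg, hg0⟩ := exists_ne_zero_mem_twoPointSpace hne hQ₁ hQ₂ (-1)
  have hgo := (Place.mem_filt_iff_ord hg0).mp (mem_twoPointSpace.mp hg).2.1
  have hpow : ∀ n : ℕ, ∃ m k : ℤ, n ≤ m ∧ ∃ f ∈ twoPointSpace Q₁ Q₂ (-m) k, f ≠ 0 ∧
      Q₁.ord f = m := by
    intro n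
    induction n with
    | zero =>
      refine ⟨0, 0, by simp, 1, mem_twoPointSpace.mpr ⟨fun Q _ _ => Q.one_mem_filt, ?_, ?_⟩,
        one_ne_zero, by simp [Place.ord]⟩
      · simpa using Q₁.one_mem_filt
      · exact Q₂.one_mem_filt
    | succ n ih =>
      obtain ⟨m, k, hm, f, hf, hf0, hfo⟩ := ih
      have hg' : g ∈ twoPointSpace Q₁ Q₂ (-Q₁.ord g) j := by
        have h1 := mem_twoPointSpace.mp hg
        exact mem_twoPointSpace.mpr ⟨h1.1, Q₁.mem_filt_neg_ord g, h1.2.2⟩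
      refine ⟨m + Q₁.ord g, k + j, by push_cast; omega, f * g, ?_, mul_ne_zero hf0 hg0, ?_⟩
      · rw [neg_add]
        exact mul_mem_twoPointSpace hf hg'
      · rw [Place.ord_mul _ hf0 hg0, hfo]
  -- The exponent ensures `i + m > i₀`; a function of pole order `i + m` times one vanishing to
  -- order `m` has pole order `i`.
  obtain ⟨m, k, hm, f, hf, hf0, hfo⟩ := hpow (i₀ - i + 1).toNat
  obtain ⟨l, h, hh, hh0, hho⟩ := hi₀ (i + m) (by omega)
  refine ⟨l + k, h * f, ?_, mul_ne_zero hh0 hf0, ?_⟩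
  · have := mul_mem_twoPointSpace hh hf
    rwa [add_neg_cancel_right] at this
  · rw [Place.ord_mul _ hh0 hf0, hfo, hho]
    ring

/-- Both nonemptiness and a lower bound are needed for `sInf` on `ℤ` to be a genuine minimum. -/
theorem isLeast_tau (hne : Q₁ ≠ Q₂) (hQ₁ : Q₁.IsRational) (hQ₂ : Q₂.IsRational) (i : ℤ) :
    IsLeast {j : ℤ | (i, j) ∈ weierstrassSemigroup Q₁ Q₂} (tau Q₁ Q₂ i) := by
  have hne' : {j : ℤ | (i, j) ∈ weierstrassSemigroup Q₁ Q₂}.Nonempty := by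
    obtain ⟨j, f, hf, hf0, hfo⟩ := exists_mem_twoPointSpace_ord_eq hne hQ₁ hQ₂ i
    refine ⟨-Q₂.ord f, Set.mem_ofPred.mpr (Set.mem_ofPred.mpr ⟨f, ?_, hf0, hfo, by simp⟩)⟩
    exact (mem_regularOutside_iff hf0).mpr (mem_twoPointSpace.mp hf).1
  have hbdd : BddBelow {j : ℤ | (i, j) ∈ weierstrassSemigroup Q₁ Q₂} := by
    obtain ⟨n, hn⟩ := exists_twoPointSpace_eq_bot hQ₂ hQ₁ i
    refine ⟨n, fun j hj => ?_⟩
    obtain ⟨f, hf, hf0, h1, h2⟩ := Set.mem_ofPred.mp (Set.mem_ofPred.mp hj)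
    by_contra hlt
    refine hf0 ((Submodule.mem_bot F).mp ?_)
    rw [← hn j (by omega), twoPointSpace_comm]
    exact mem_twoPointSpace.mpr ⟨(mem_regularOutside_iff hf0).mp hf,
      (Place.mem_filt_iff_ord hf0).mpr h1.ge, (Place.mem_filt_iff_ord hf0).mpr h2.ge⟩
  exact ⟨Int.csInf_mem hne' hbdd, fun j hj => csInf_le hbdd hj⟩

/-- Subtracting minimal functions successively removes the poles at `Q₁`. -/
theorem twoPointSpace_le_span (hne : Q₁ ≠ Q₂) (hQ₁ : Q₁.IsRational) (hQ₂ : Q₂.IsRational)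
    {f : ℤ → K} (hf : ∀ i, IsMinimalFunction Q₁ Q₂ i (f i)) (a b : ℤ) :
    twoPointSpace Q₁ Q₂ a b ≤ Submodule.span F (f '' {i | i ≤ a ∧ tau Q₁ Q₂ i ≤ b}) := by
  obtain ⟨n, hn⟩ := exists_twoPointSpace_eq_bot hQ₁ hQ₂ b
  have key : ∀ k : ℕ, n + k ≤ a → twoPointSpace Q₁ Q₂ (n + k) b ≤
      Submodule.span F (f '' {i | i ≤ a ∧ tau Q₁ Q₂ i ≤ b}) := by
    intro k
    induction k with
    | zero =>
      intro _
      rw [Nat.cast_zero, add_zero, hn n le_rfl]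
      exact bot_le
    | succ k ih =>
      intro hk g hg
      rw [Nat.cast_succ, ← add_assoc] at hk hg
      have h1 := mem_twoPointSpace.mp hg
      by_cases hg1 : g ∈ Q₁.filt (n + k)
      · exact ih (by omega) (mem_twoPointSpace.mpr ⟨h1.1, hg1, h1.2.2⟩)
      · obtain ⟨hg0, hgo⟩ := Place.ord_eq_of_mem_of_notMem h1.2.1
          (by rwa [add_sub_cancel_right])
        -- `g` itself bounds `tau`, so the minimal function to be subtracted lies in the allowed
        -- range.
        have htau : tau Q₁ Q₂ (n + k + 1) ≤ b := by
          have h2 : tau Q₁ Q₂ (n + k + 1) ≤ -Q₂.ord g :=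
            (isLeast_tau hne hQ₁ hQ₂ (n + k + 1)).2 (Set.mem_ofPred.mpr (Set.mem_ofPred.mpr
              ⟨g, (mem_regularOutside_iff hg0).mpr h1.1, hg0, hgo, by simp⟩))
          have h3 := (Place.mem_filt_iff_ord hg0).mp h1.2.2
          omega
        have hfm := hf (n + k + 1)
        obtain ⟨c, hc⟩ := hQ₁.exists_sub_smul_mem h1.2.1 hfm.2.1 hfm.2.2.1
        rw [add_sub_cancel_right] at hc
        have h4 := mem_twoPointSpace.mp
          (sub_mem hg (Submodule.smul_mem _ c (hfm.mem_twoPointSpace le_rfl htau)))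
        rw [← sub_add_cancel g (c • f (n + k + 1))]
        exact add_mem (ih (by omega) (mem_twoPointSpace.mpr ⟨h4.1, hc, h4.2.2⟩))
          (Submodule.smul_mem _ _ (Submodule.subset_span ⟨_, ⟨hk, htau⟩, rfl⟩))
  rcases le_total a n with ha | ha
  · rw [hn a ha]
    exact bot_le
  · have := key (a - n).toNat (by omega)
    rwa [show n + ((a - n).toNat : ℤ) = a by omega] at this

end

end FunctionFields

/-! ### The basis and the dimension formula -/

theorem mainTheorem6 {F K : Type*} [Field F] [Finite F] [Field K] [Algebra F K]
    [Algebra (RatFunc F) K] [IsScalarTower F (RatFunc F) K] [FunctionField F K]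
    (Q₁ Q₂ : Place F K) (hQ₁ : Q₁.IsRational) (hQ₂ : Q₂.IsRational) (hne : Q₁ ≠ Q₂)
    (a₁ a₂ : ℕ) :
    (∀ i : ℤ, IsLeast {j : ℤ | (i, j) ∈ weierstrassSemigroup Q₁ Q₂} (tau Q₁ Q₂ i)) ∧
    {i : ℤ | i ≤ a₁ ∧ tau Q₁ Q₂ i ≤ a₂}.Finite ∧
    Module.finrank F
        (riemannRochSpace (Finsupp.single Q₁ (a₁ : ℤ) + Finsupp.single Q₂ (a₂ : ℤ))) =
      {i : ℤ | i ≤ a₁ ∧ tau Q₁ Q₂ i ≤ a₂}.ncard ∧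
    ∀ f : ℤ → K, (∀ i : ℤ, IsMinimalFunction Q₁ Q₂ i (f i)) →
      ∃ b : Module.Basis {i : ℤ | i ≤ a₁ ∧ tau Q₁ Q₂ i ≤ a₂} F
          (riemannRochSpace (Finsupp.single Q₁ (a₁ : ℤ) + Finsupp.single Q₂ (a₂ : ℤ))),
        ∀ i, (b i : K) = f i := by
  have := FunctionField.finiteOverTranscendental F K
  have hleast := isLeast_tau hne hQ₁ hQ₂
  rw [riemannRochSpace_eq_twoPointSpace hne]
  have hfin := finiteDimensional_twoPointSpace hQ₁ hQ₂ a₁ a₂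
  have hbasis : ∀ f : ℤ → K, (∀ i : ℤ, IsMinimalFunction Q₁ Q₂ i (f i)) →
      ∃ b : Module.Basis {i : ℤ | i ≤ a₁ ∧ tau Q₁ Q₂ i ≤ a₂} F
          (twoPointSpace Q₁ Q₂ (a₁ : ℤ) (a₂ : ℤ)), ∀ i, (b i : K) = f i := by
    intro f hf
    let v : {i : ℤ | i ≤ a₁ ∧ tau Q₁ Q₂ i ≤ a₂} → twoPointSpace Q₁ Q₂ (a₁ : ℤ) (a₂ : ℤ) :=
      fun i => ⟨f i, (hf i).mem_twoPointSpace i.2.1 i.2.2⟩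
    have hv : LinearIndependent F v := LinearIndependent.of_comp (Submodule.subtype _)
      ((linearIndependent_isMinimalFunction hf).comp _ Subtype.val_injective)
    have hspan : ⊤ ≤ Submodule.span F (Set.range v) := by
      rw [← Submodule.map_le_map_iff_of_injective (Submodule.subtype_injective _),
        Submodule.map_span, ← Set.range_comp, Submodule.map_top, Submodule.range_subtype]
      have h := twoPointSpace_le_span hne hQ₁ hQ₂ hf a₁ a₂
      rw [Set.image_eq_range] at h
      exact h
    exact ⟨Module.Basis.mk hv hspan, fun i => by rw [Module.Basis.mk_apply]⟩
  -- The basis from any one choice of minimal functions gives both the finiteness of the index set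
  -- and the dimension.
  have hex : ∀ i, ∃ f, IsMinimalFunction Q₁ Q₂ i f := fun i =>
    Set.mem_ofPred.mp (Set.mem_ofPred.mp (hleast i).1)
  choose f hf using hex
  obtain ⟨b, -⟩ := hbasis f hf
  have : Finite {i : ℤ | i ≤ a₁ ∧ tau Q₁ Q₂ i ≤ a₂} := Module.Finite.finite_basis b
  exact ⟨hleast, Set.toFinite _, Module.finrank_eq_nat_card_basis b, hbasis⟩
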